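/- Let $K$ be a number field with exactly $s>0$ real embeddings $\sigma_1,\dots,\sigma_s$ and $2t>0$ non-real complex embeddings $\sigma_{s+1},\dots,\sigma_{s+2t}$, labelled so that $\sigma_{s+t+j}=\overline{\sigma_{s+j}}$ for $1\le j\le t$. Let $U$ be an admissible subgroup of the group $\mathcal O_K^{*,+}$ of totally positive units of $K$ (units $u$ with $\sigma_i(u)>0$ for all $i\le s$), that is, a subgroup of rank $s$ such that $\{(\log|\sigma_1(u)|,\dots,\log|\sigma_s(u)|) : u\in U\}$ is a full lattice in $\mathbb R^s$. Let $X(K,U)$ be the associated Oeljeklaus–Toma manifold, i.e. the complex manifold which is the quotient of $\mathbb H^s\times\mathbb C^t$ ($\mathbb H$ the upper half plane) by the free and properly discontinuous action of $U\ltimes\mathcal O_K$ given by $$(u,a)\cdot(z_i)_{1\le i\le s+t}=\bigl(\sigma_i(u)z_i+\sigma_i(a)\bigr)_{1\le i\le s+t}.$$ A complex manifold $X$ with $\dim_{\mathbb C}X>1$ is said to have a locally conformally Kähler (lck) metric if there are a connected normal (Galois) holomorphic covering $\tilde X\to X$ and a Kähler form $\tilde\omega$ on $\tilde X$ such that for every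 deck transformation $\gamma$ there is a constant $\chi(\gamma)>0$ with $\gamma^*\tilde\omega=\chi(\gamma)\,\tilde\omega$. **Theorem.** If $1<s<t$, then $X(K,U)$ has no lck metric. -/

import Mathlib

open scoped Manifold ContDiff Topology

/-! ## Kähler forms and locally conformally Kähler manifolds -/

section LCK

universe u

variable (E : Type*) [NormedAddCommGroup E] [NormedSpace ℂ E]

/-- Real differential 2-forms (no regularity imposed) on a complex manifold modelled on `E`. -/
def TwoForm (Y : Type*) [TopologicalSpace Y] [ChartedSpace E Y] : Type _ :=
  ∀ y : Y, TangentSpace 𝓘(ℂ, E) y [⋀^Fin 2]→L[ℝ] ℝ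

variable {E}

/-- The pull-back `f^* η` of a 2-form along a (holomorphic) map `f`. -/
noncomputable def TwoForm.pullback {Y Z : Type*} [TopologicalSpace Y] [ChartedSpace E Y]
    [TopologicalSpace Z] [ChartedSpace E Z] (f : Y → Z) (η : TwoForm E Z) : TwoForm E Y :=
  fun y => (η (f y)).compContinuousLinearMap
    ((mfderiv 𝓘(ℂ, E) 𝓘(ℂ, E) f y).restrictScalars ℝ)

/-- The expression of a 2-form in a chart `e`: a 2-form on the model space `E`
(meaningful on the open set `e.target`). -/
noncomputable def TwoForm.inChart {Y : Type*} [TopologicalSpace Y] [ChartedSpace E Y]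
    (η : TwoForm E Y) (e : OpenPartialHomeomorph Y E) : E → E [⋀^Fin 2]→L[ℝ] ℝ :=
  TwoForm.pullback (Y := E) e.symm η

/-- A Kähler form: a smooth closed real 2-form of type (1,1) which is positive. -/
structure TwoForm.IsKahler {Y : Type*} [TopologicalSpace Y] [ChartedSpace E Y]
    (η : TwoForm E Y) : Prop where
  smooth : ∀ e ∈ atlas E Y, ContDiffOn ℝ ∞ (η.inChart e) e.target
  closed : ∀ e ∈ atlas E Y, ∀ z ∈ e.target, extDeriv (η.inChart e) z = 0
  type_one_one : ∀ (y : Y) (v w : TangentSpace 𝓘(ℂ, E) y),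
    η y ![Complex.I • v, Complex.I • w] = η y ![v, w]
  positive : ∀ (y : Y) (v : TangentSpace 𝓘(ℂ, E) y), v ≠ 0 → 0 < η y ![v, Complex.I • v]

/-- A homeomorphism `γ` of the total space of `p : Y → X` is a deck transformation. -/
def IsDeckTransformation {Y X : Type*} [TopologicalSpace Y] (p : Y → X) (γ : Y ≃ₜ Y) : Prop :=
  ∀ y, p (γ y) = p y

variable (E) in
/-- A complex manifold `X` modelled on `E` is locally conformally Kähler (carries an lck metric)
if `dim X > 1` and `X` has a connected normal (Galois) holomorphic covering `p : Y → X`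
with a Kähler form `η` on `Y` on which all deck transformations act by homotheties. -/
def IsLCK (X : Type u) [TopologicalSpace X] [ChartedSpace E X]
    [IsManifold 𝓘(ℂ, E) ω X] : Prop :=
  1 < Module.finrank ℂ E ∧
  ∃ (Y : Type u) (_ : TopologicalSpace Y) (_ : ChartedSpace E Y)
    (_ : IsManifold 𝓘(ℂ, E) ω Y) (p : Y → X) (η : TwoForm E Y),
    ConnectedSpace Y ∧ IsCoveringMap p ∧ Function.Surjective p ∧
    IsLocalDiffeomorph 𝓘(ℂ, E) 𝓘(ℂ, E) ω p ∧
    (∀ y y' : Y, p y = p y' → ∃ γ : Y ≃ₜ Y, IsDeckTransformation p γ ∧ γ y = y') ∧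
    TwoForm.IsKahler η ∧
    ∀ γ : Y ≃ₜ Y, IsDeckTransformation p γ →
      ∃ χ : ℝ, 0 < χ ∧ ∀ y, TwoForm.pullback γ η y = χ • η y

end LCK

/-! ## Oeljeklaus–Toma manifolds -/

section OT

open NumberField

/-- The coordinate space `ℂ^s × ℂ^t`. -/
abbrev OTModel (s t : ℕ) : Type := Fin s ⊕ Fin t → ℂ

/-- The open subset `ℍ^s × ℂ^t` of `ℂ^(s+t)`. -/
def OTDomain (s t : ℕ) : TopologicalSpace.Opens (OTModel s t) where
  carrier := {z | ∀ i : Fin s, 0 < (z (Sum.inl i)).im}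
  is_open' := by
    simp only [Set.ofPred_forall]
    exact isOpen_iInter_of_finite fun i =>
      isOpen_lt continuous_const (Complex.continuous_im.comp (continuous_apply _))

variable {K : Type*} [Field K] [NumberField K] {s t : ℕ}

/-- The first `s` coordinates `u ↦ (log |σ_1(u)|, …, log |σ_s(u)|)` of the logarithmic embedding
of the units. -/
noncomputable def logProj (σ : Fin s ⊕ Fin t → (K →+* ℂ)) :
    Additive (𝓞 K)ˣ →+ (Fin s → ℝ) where
  toFun u i := Real.log ‖σ (Sum.inl i) ((u.toMul : 𝓞 K) : K)‖
  map_zero' := by ext i; simp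
  map_add' u v := by
    ext i
    have h : ∀ w : (𝓞 K)ˣ, ‖σ (Sum.inl i) ((w : 𝓞 K) : K)‖ ≠ 0 := fun w => by
      simp
    simp [Real.log_mul (h _) (h _)]

/-- Admissible subgroups: subgroups of rank `s` of the totally positive units whose projection to
the first `s` coordinates of the logarithmic embedding is a full lattice in `ℝ^s`. (Here the
`σ (inl i)` are supposed to be the real embeddings.) -/
structure IsAdmissible (σ : Fin s ⊕ Fin t → (K →+* ℂ)) (U : Subgroup (𝓞 K)ˣ) : Prop where
  totallyPositive : ∀ u ∈ U, ∀ i : Fin s, 0 < (σ (Sum.inl i) ((u : 𝓞 K) : K)).re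
  rank_eq : Module.finrank ℤ (Additive U) = s
  discrete : DiscreteTopology ((Subgroup.toAddSubgroup U).map (logProj σ))
  full : Submodule.span ℝ (((Subgroup.toAddSubgroup U).map (logProj σ) :
    AddSubgroup (Fin s → ℝ)) : Set (Fin s → ℝ)) = ⊤

/-- The data defining an Oeljeklaus–Toma manifold: a number field `K` with `s > 0` real and
`2t > 0` complex embeddings, a labelling `σ_1, …, σ_{s+2t}` of all its embeddings with
`σ_1, …, σ_s` real and `σ_{s+t+j}` the complex conjugate of `σ_{s+j}` (only
`σ_1, …, σ_{s+t}` are recorded; by bijectivity `σ_{s+j}` is then not real), and an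
admissible subgroup `U` of units. -/
structure OTData (K : Type*) [Field K] [NumberField K] (s t : ℕ) where
  s_pos : 0 < s
  t_pos : 0 < t
  σ : Fin s ⊕ Fin t → (K →+* ℂ)
  isReal : ∀ i : Fin s, ComplexEmbedding.IsReal (σ (Sum.inl i))
  bijective : Function.Bijective
    (Sum.elim σ fun j : Fin t => ComplexEmbedding.conjugate (σ (Sum.inr j)))
  U : Subgroup (𝓞 K)ˣ
  admissible : IsAdmissible σ U

namespace OTData

variable (D : OTData K s t)

/-- The action of `U` on the additive group of `𝓞 K` by multiplication. -/
def unitAction : D.U →* MulAut (Multiplicative (𝓞 K)) :=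
  ((MulAutMultiplicative (𝓞 K)).symm.toMonoidHom.comp
    (DistribMulAction.toAddAut (𝓞 K)ˣ (𝓞 K))).comp D.U.subtype

/-- The group `U ⋉ 𝓞 K`. -/
abbrev Γ : Type _ := Multiplicative (𝓞 K) ⋊[D.unitAction] D.U

/-- The affine map `z_i ↦ σ_i(u) z_i + σ_i(a)` of `ℂ^s × ℂ^t`. -/
def affine (g : D.Γ) (z : OTModel s t) : OTModel s t := fun i =>
  D.σ i (((g.right : (𝓞 K)ˣ) : 𝓞 K) : K) * z i + D.σ i ((g.left.toAdd : 𝓞 K) : K)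

lemma real_im (x : K) (i : Fin s) : (D.σ (Sum.inl i) x).im = 0 := by
  have := RingHom.congr_fun (D.isReal i) x
  simpa [Complex.conj_eq_iff_im] using this

lemma affine_im (g : D.Γ) (z : OTModel s t) (i : Fin s) :
    (D.affine g z (Sum.inl i)).im =
      (D.σ (Sum.inl i) (((g.right : (𝓞 K)ˣ) : 𝓞 K) : K)).re * (z (Sum.inl i)).im := by
  simp [affine, Complex.mul_im, D.real_im]

lemma affine_mem (g : D.Γ) {z : OTModel s t} (hz : z ∈ OTDomain s t) :
    D.affine g z ∈ OTDomain s t := fun i => by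
  rw [affine_im]
  exact mul_pos (D.admissible.totallyPositive _ g.right.2 i) (hz i)

/-- The action of `U ⋉ 𝓞 K` on `ℍ^s × ℂ^t`. -/
instance : MulAction D.Γ (OTDomain s t) where
  smul g z := ⟨D.affine g z, D.affine_mem g z.2⟩
  one_smul z := by
    apply Subtype.ext
    funext i
    change D.affine 1 z i = _
    simp [affine]
  mul_smul g h z := by
    apply Subtype.ext
    funext i
    change D.affine (g * h) z i = D.affine g (D.affine h z) i
    have : ((g * h).left.toAdd : 𝓞 K) =
        g.left.toAdd + ((g.right : (𝓞 K)ˣ) : 𝓞 K) * h.left.toAdd := rfl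
    simp only [affine, this, SemidirectProduct.mul_right, Subgroup.coe_mul, Units.val_mul,
      map_mul, map_add]
    ring

lemma coe_smul (g : D.Γ) (z : OTDomain s t) : ((g • z : OTDomain s t) : OTModel s t) =
    D.affine g z := rfl

lemma contDiff_affine (g : D.Γ) : ContDiff ℂ ω (D.affine g) := by
  unfold affine
  fun_prop

instance : ContinuousConstSMul D.Γ (OTDomain s t) where
  continuous_const_smul g := by
    apply Continuous.subtype_mk
    exact (D.contDiff_affine g).continuous.comp continuous_subtype_val

/-- The Oeljeklaus–Toma manifold `X(K, U)`: the quotient of `ℍ^s × ℂ^t` by `U ⋉ 𝓞 K`. -/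
def X : Type := MulAction.orbitRel.Quotient D.Γ (OTDomain s t)

instance : TopologicalSpace D.X :=
  inferInstanceAs (TopologicalSpace (Quotient (MulAction.orbitRel D.Γ (OTDomain s t))))

/-- The quotient map `ℍ^s × ℂ^t → X(K, U)`. -/
def proj : OTDomain s t → D.X := Quotient.mk (MulAction.orbitRel D.Γ (OTDomain s t))

/-- `U ⋉ 𝓞 K` acts freely and properly discontinuously on `ℍ^s × ℂ^t`. -/
theorem isQuotientCoveringMap_proj : IsQuotientCoveringMap D.proj D.Γ where
  toIsQuotientMap := isQuotientMap_quotient_mk'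
  toContinuousConstSMul := inferInstance
  apply_eq_iff_mem_orbit := Quotient.eq
  disjoint z₀ := by
    have hs : Nonempty (Fin s) := ⟨⟨0, D.s_pos⟩⟩
    let F : OTDomain s t → (Fin s → ℝ) := fun z i => Real.log ((z : OTModel s t) (Sum.inl i)).im
    have hF : Continuous F := by
      refine continuous_pi fun i => Continuous.log ?_ fun z => (z.2 i).ne'
      exact Complex.continuous_im.comp ((continuous_apply _).comp continuous_subtype_val)
    have hFg : ∀ (g : D.Γ) (z : OTDomain s t),
        F (g • z) = logProj D.σ (Additive.ofMul (g.right : (𝓞 K)ˣ)) + F z := by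
      intro g z
      funext i
      have h0 := D.admissible.totallyPositive _ g.right.2 i
      have h1 : ‖D.σ (Sum.inl i) (((g.right : (𝓞 K)ˣ) : 𝓞 K) : K)‖ =
          (D.σ (Sum.inl i) (((g.right : (𝓞 K)ˣ) : 𝓞 K) : K)).re := by
        rw [← Complex.abs_re_eq_norm.2 (D.real_im _ i), abs_of_pos h0]
      have h2 : logProj D.σ (Additive.ofMul (g.right : (𝓞 K)ˣ)) i =
          Real.log (D.σ (Sum.inl i) (((g.right : (𝓞 K)ˣ) : 𝓞 K) : K)).re := by
        rw [← h1]; rfl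
      rw [Pi.add_apply, h2]
      simp only [F, coe_smul, affine_im]
      exact Real.log_mul h0.ne' (z.2 i).ne'
    have := D.admissible.discrete
    obtain ⟨ε, hε, hL⟩ : ∃ ε > 0, ∀ u : (𝓞 K)ˣ, u ∈ D.U →
        ‖logProj D.σ (Additive.ofMul u)‖ < ε → logProj D.σ (Additive.ofMul u) = 0 := by
      obtain ⟨ε, hε, h⟩ := Metric.isOpen_iff.1
        (isOpen_discrete ({0} : Set ((Subgroup.toAddSubgroup D.U).map (logProj D.σ)))) 0 rfl
      refine ⟨ε, hε, fun u hu hlt => ?_⟩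
      have := @h ⟨logProj D.σ (Additive.ofMul u), ⟨Additive.ofMul u, hu, rfl⟩⟩ (by
        simpa [Metric.mem_ball, Subtype.dist_eq] using hlt)
      exact congrArg Subtype.val this
    refine ⟨(F ⁻¹' Metric.ball (F z₀) (ε / 2)) ∩ Metric.ball z₀ (1 / 2),
      Filter.inter_mem (hF.continuousAt (Metric.ball_mem_nhds _ (half_pos hε)))
        (Metric.ball_mem_nhds _ (by norm_num)), ?_⟩
    rintro g ⟨_, ⟨w, ⟨hw1, hw2⟩, rfl⟩, hg1, hg2⟩
    simp only [Set.mem_preimage] at hw1 hg1 hw2 hg2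
    have hu0 : logProj D.σ (Additive.ofMul (g.right : (𝓞 K)ˣ)) = 0 := by
      refine hL _ g.right.2 ?_
      have h3 := dist_triangle_right (F (g • w)) (F w) (F z₀)
      have h4 : dist (F (g • w)) (F w) = ‖logProj D.σ (Additive.ofMul (g.right : (𝓞 K)ˣ))‖ := by
        rw [hFg, dist_eq_norm, add_sub_cancel_right]
      rw [← h4]
      have h5 := Metric.mem_ball.1 hw1
      have h6 := Metric.mem_ball.1 hg1
      linarith
    have hu : g.right = 1 := by
      let i : Fin s := hs.some
      have h0 := D.admissible.totallyPositive _ g.right.2 i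
      have h1 : Real.log ‖D.σ (Sum.inl i) (((g.right : (𝓞 K)ˣ) : 𝓞 K) : K)‖ = 0 :=
        congrFun hu0 i
      rw [← Complex.abs_re_eq_norm.2 (D.real_im _ i), abs_of_pos h0] at h1
      have h2 := Real.eq_one_of_pos_of_log_eq_zero h0 h1
      have h3 : D.σ (Sum.inl i) (((g.right : (𝓞 K)ˣ) : 𝓞 K) : K) = 1 :=
        Complex.ext (by simpa using h2) (by simpa using D.real_im _ i)
      have h4 : (((g.right : (𝓞 K)ˣ) : 𝓞 K) : K) = 1 :=
        (D.σ (Sum.inl i)).injective (by rw [h3, map_one])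
      apply Subtype.ext
      apply Units.ext
      apply RingOfIntegers.ext
      simpa using h4
    have hnorm : ∀ i, ‖D.σ i ((g.left.toAdd : 𝓞 K) : K)‖ < 1 := by
      intro i
      have h3 := dist_triangle_right (g • w) w z₀
      have h5 := Metric.mem_ball.1 hw2
      have h6 := Metric.mem_ball.1 hg2
      have h7 : dist (g • w) w < 1 := by linarith
      have h8 := (dist_le_pi_dist ((g • w : OTDomain s t) : OTModel s t) w i).trans_lt h7
      have h9 : ((g • w : OTDomain s t) : OTModel s t) i - (w : OTModel s t) i =
          D.σ i ((g.left.toAdd : 𝓞 K) : K) := by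
        simp [coe_smul, affine, hu]
      rwa [dist_eq_norm, h9] at h8
    have hplace : ∀ v : InfinitePlace K, v ((g.left.toAdd : 𝓞 K) : K) < 1 := by
      intro v
      rw [← InfinitePlace.norm_embedding_eq]
      obtain ⟨i, hi⟩ := D.bijective.2 v.embedding
      rw [← hi]
      rcases i with i | j
      · exact hnorm i
      · simpa [ComplexEmbedding.conjugate_coe_eq] using hnorm (Sum.inr j)
    have ha : (g.left.toAdd : 𝓞 K) = 0 := by
      by_contra hne
      let v : InfinitePlace K := InfinitePlace.mk (D.σ (Sum.inl hs.some))
      exact absurd (hplace v)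
        (not_lt.2 (InfinitePlace.one_le_of_lt_one (w := v) hne fun z _ => hplace z))
    exact SemidirectProduct.ext ha hu

lemma domain_nonempty : Nonempty (OTDomain s t) :=
  ⟨⟨fun _ => Complex.I, fun _ => by simp⟩⟩

/-- The chart of `X(K, U)` given by a local inverse of the quotient map: `e` is the restriction
of the quotient map to an open subset of `ℍ^s × ℂ^t` on which it is injective. -/
noncomputable def chart (e : OpenPartialHomeomorph (OTDomain s t) D.X) :
    OpenPartialHomeomorph D.X (OTModel s t) :=
  e.symm ≫ₕ (OTDomain s t).openPartialHomeomorphSubtypeCoe domain_nonempty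

lemma exists_local_inverse (x : D.X) : ∃ e : OpenPartialHomeomorph (OTDomain s t) D.X,
    ⇑e = D.proj ∧ x ∈ e.target := by
  obtain ⟨z, rfl⟩ := D.isQuotientCoveringMap_proj.surjective x
  obtain ⟨e, hz, he⟩ := D.isQuotientCoveringMap_proj.isCoveringMap.isLocalHomeomorph z
  refine ⟨e, he.symm, ?_⟩
  rw [he]
  exact e.map_source hz

/-- The complex atlas of `X(K, U)`: all local inverses of the quotient map. -/
noncomputable instance : ChartedSpace (OTModel s t) D.X where
  atlas := {c | ∃ e : OpenPartialHomeomorph (OTDomain s t) D.X, ⇑e = D.proj ∧ c = D.chart e}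
  chartAt x := D.chart (D.exists_local_inverse x).choose
  mem_chart_source x := by
    simpa [chart] using (D.exists_local_inverse x).choose_spec.2
  chart_mem_atlas x := ⟨_, (D.exists_local_inverse x).choose_spec.1, rfl⟩

/-- `X(K, U)` is a complex manifold. -/
instance : IsManifold 𝓘(ℂ, OTModel s t) ω D.X := by
  apply isManifold_of_contDiffOn
  rintro _ _ ⟨e, he, rfl⟩ ⟨e', he', rfl⟩
  intro z hz
  apply ContDiffAt.contDiffWithinAt
  simp only [modelWithCornersSelf_coe, modelWithCornersSelf_coe_symm, Function.comp_id,
    Function.id_comp, Set.preimage_id, Set.range_id, Set.inter_univ] at hz ⊢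
  have hz1 : z ∈ (D.chart e).target := hz.1
  have hz2 : (D.chart e).symm z ∈ (D.chart e').source := hz.2
  let ι := (OTDomain s t).openPartialHomeomorphSubtypeCoe domain_nonempty
  have hι : ∀ w : OTDomain s t, ι.symm (w : OTModel s t) = w := fun w =>
    ι.left_inv (x := w) (Set.mem_univ _)
  have hzD : z ∈ OTDomain s t := by
    have := hz1.1
    simpa using this
  obtain ⟨w, rfl⟩ : ∃ w : OTDomain s t, (w : OTModel s t) = z := ⟨⟨z, hzD⟩, rfl⟩
  have hsymm : ∀ v : OTDomain s t, (D.chart e).symm (v : OTModel s t) = D.proj v := fun v => by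
    change e (ι.symm v) = _
    rw [hι, he]
  have hw : D.proj w ∈ e'.target := by
    have := hz2.1
    rwa [hsymm] at this
  have hproj : D.proj (e'.symm (D.proj w)) = D.proj w := by
    rw [← he', e'.right_inv (he' ▸ hw)]
  obtain ⟨g, hg⟩ := D.isQuotientCoveringMap_proj.apply_eq_iff_mem_orbit.1 hproj
  have hgs : g • w ∈ e'.source := by
    have : g • w = e'.symm (D.proj w) := hg
    rw [this]
    exact e'.map_target hw
  have hev : ∀ᶠ v in 𝓝 (w : OTModel s t), (D.chart e') ((D.chart e).symm v) = D.affine g v := by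
    have h1 : ∀ᶠ v : OTDomain s t in 𝓝 w, g • v ∈ e'.source :=
      (continuous_const_smul g).continuousAt.preimage_mem_nhds (e'.open_source.mem_nhds hgs)
    have h2 := (OTDomain s t).isOpen.isOpenEmbedding_subtypeVal.map_nhds_eq w
    rw [← h2]
    refine Filter.eventually_map.2 (h1.mono fun v hv => ?_)
    change D.chart e' ((D.chart e).symm (v : OTModel s t)) = D.affine g v
    rw [hsymm, ← D.coe_smul]
    change ((e'.symm (D.proj v) : OTDomain s t) : OTModel s t) = _
    rw [← D.isQuotientCoveringMap_proj.map_smul g, ← he', e'.left_inv hv]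
  exact ((D.contDiff_affine g).contDiffAt).congr_of_eventuallyEq hev

end OTData

end OT

/-! Suppose an lck structure exists, with Kähler covering Y. The domain ℍ^s × ℂ^t is contractible,
so its projection to X(K,U) lifts to Y, and the Kähler form pulls back to a closed positive form θ
on the domain. Since the covering is normal, each element of U ⋉ 𝓞 K is intertwined with a deck
transformation. Hence θ is homothetic under U ⋉ 𝓞 K, with factors forming a positive character χ
(`exists_deck`, `pullback_lift_homothetic`, `exists_character`).

The character kills translations (`character_translation`), so the coefficients of θ are 𝓞
K-periodic and can be averaged over the torus (𝓞 K ⊗ ℝ)/𝓞 K. The real span of 𝓞 K contains every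
coordinate direction e_j of ℂ^t, so derivatives along e_j and i·e_j average to zero. By closedness
the average of θ(e_j, i·e_j) is then a positive constant. A unit u multiplies it by |σ_{s+j}(u)|² on
one side and by χ(u) on the other, so |σ_{s+j}(u)|² = χ(u) for every j (`norm_sq_eq_character`).

It remains to show that the non-real conjugates of the units in U cannot all have equal absolute
value when s < t (`not_forall_norm_eq`). Equality gives σ_{s+j}·σ̄_{s+j} = σ_{s+k}·σ̄_{s+k} on U. A
Galois permutation of embeddings makes one factor on the left real, while s < t allows k to be
chosen so that the right side stays non-real. Taking logarithms gives a nontrivial linear relation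
on the log lattice of U, which spans ℝ^s. -/

open NumberField MeasureTheory Module

/-! ### Conjugates of units and the arithmetic contradiction -/

section Embeddings

variable {K : Type*} [Field K] [NumberField K]

/-- Galois transitivity on the complex embeddings of a number field: any embedding can be moved to
any other by a permutation which preserves multiplicative relations between conjugates. -/
theorem exists_perm_embeddings (σ τ : K →+* ℂ) : ∃ π : Equiv.Perm (K →+* ℂ), π σ = τ ∧
    ∀ (x : K) (φ ψ φ' ψ' : K →+* ℂ), φ x * ψ x = φ' x * ψ' x →
      π φ x * π ψ x = π φ' x * π ψ' x := by
  let A := AlgebraicClosure K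
  have key : ∀ σ : K →+* ℂ, ∃ f : A →+* ℂ, f.comp (algebraMap K A) = σ := by
    intro σ
    let _ := σ.toAlgebra
    exact ⟨(IsAlgClosed.lift : A →ₐ[K] ℂ).toRingHom,
      (IsAlgClosed.lift : A →ₐ[K] ℂ).comp_algebraMap⟩
  have hbij : ∀ f : A →+* ℂ, Function.Bijective (fun φ : K →+* A => f.comp φ) := by
    intro f
    refine (Fintype.bijective_iff_injective_and_card _).2 ⟨fun φ ψ h => ?_, ?_⟩
    · ext x
      exact f.injective (RingHom.congr_fun h x)
    · rw [Embeddings.card, Embeddings.card]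
  obtain ⟨f, hf⟩ := key σ
  obtain ⟨g, hg⟩ := key τ
  let eF := Equiv.ofBijective _ (hbij f)
  let eG := Equiv.ofBijective _ (hbij g)
  have hF : ∀ (φ : K →+* ℂ) (x : K), f (eF.symm φ x) = φ x := fun φ x =>
    RingHom.congr_fun (eF.apply_symm_apply φ) x
  refine ⟨eF.symm.trans eG, ?_, ?_⟩
  · have : eF.symm σ = algebraMap K A := by
      rw [Equiv.symm_apply_eq]
      exact hf.symm
    rw [Equiv.trans_apply, this]
    exact hg
  · intro x φ ψ φ' ψ' h
    have h1 : eF.symm φ x * eF.symm ψ x = eF.symm φ' x * eF.symm ψ' x := by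
      apply f.injective
      simp only [map_mul, hF, h]
    change g (eF.symm φ x) * g (eF.symm ψ x) = g (eF.symm φ' x) * g (eF.symm ψ' x)
    rw [← map_mul, ← map_mul, h1]

theorem prod_norm_embeddings_unit (u : (𝓞 K)ˣ) : ∏ φ : K →+* ℂ, ‖φ ((u : 𝓞 K) : K)‖ = 1 := by
  have h1 := Algebra.norm_eq_prod_embeddings ℚ ℂ ((u : 𝓞 K) : K)
  have h2 := (NumberField.isUnit_iff_norm (K := K)).1 u.isUnit
  rw [← Fintype.prod_equiv (RingHom.equivRatAlgHom K ℂ) (fun φ => φ ((u : 𝓞 K) : K))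
    (fun φ => φ ((u : 𝓞 K) : K)) fun φ => rfl] at h1
  rw [← norm_prod, ← h1]
  have h3 : (RingOfIntegers.norm ℚ (u : 𝓞 K) : ℚ) = Algebra.norm ℚ ((u : 𝓞 K) : K) :=
    RingOfIntegers.coe_norm _ _
  rw [h3] at h2
  rw [eq_ratCast, Complex.norm_ratCast]
  exact_mod_cast h2

namespace OTData

variable {s t : ℕ} (D : OTData K s t)

theorem conjugate_inl (i : Fin s) :
    ComplexEmbedding.conjugate (D.σ (Sum.inl i)) = D.σ (Sum.inl i) :=
  ComplexEmbedding.isReal_iff.1 (D.isReal i)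

theorem injective_σ : Function.Injective D.σ := fun a b h =>
  Sum.inl_injective (D.bijective.1 (a₁ := Sum.inl a) (a₂ := Sum.inl b) h)

theorem conjugate_inr_ne (j : Fin t) (a : Fin s ⊕ Fin t) :
    ComplexEmbedding.conjugate (D.σ (Sum.inr j)) ≠ D.σ a := fun h =>
  Sum.inr_ne_inl (D.bijective.1 (a₁ := Sum.inr j) (a₂ := Sum.inl a) h)

theorem injective_conjugate_inr :
    Function.Injective fun j : Fin t => ComplexEmbedding.conjugate (D.σ (Sum.inr j)) := fun a b h =>
  Sum.inr_injective (D.bijective.1 (a₁ := Sum.inr a) (a₂ := Sum.inr b) h)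

theorem exists_eq (φ : K →+* ℂ) : (∃ i, φ = D.σ (Sum.inl i)) ∨
    ∃ j, φ = D.σ (Sum.inr j) ∨ φ = ComplexEmbedding.conjugate (D.σ (Sum.inr j)) := by
  obtain ⟨(i | j) | j, rfl⟩ := D.bijective.2 φ
  · exact Or.inl ⟨i, rfl⟩
  · exact Or.inr ⟨j, Or.inl rfl⟩
  · exact Or.inr ⟨j, Or.inr rfl⟩

theorem norm_conjugate {K : Type*} [Field K] (φ : K →+* ℂ) (x : K) : ‖ComplexEmbedding.conjugate φ x‖ = ‖φ x‖ := by
  simp [ComplexEmbedding.conjugate_coe_eq]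

/-- Logarithm of |N(u)| = 1; the factor 2 counts each non-real embedding with its conjugate. -/
theorem sum_log_norm (u : (𝓞 K)ˣ) : ∑ i, Real.log ‖D.σ (Sum.inl i) ((u : 𝓞 K) : K)‖ +
    2 * ∑ j, Real.log ‖D.σ (Sum.inr j) ((u : 𝓞 K) : K)‖ = 0 := by
  have h := prod_norm_embeddings_unit u
  rw [← Fintype.prod_bijective _ D.bijective _ (fun φ => ‖φ ((u : 𝓞 K) : K)‖) fun _ => rfl] at h
  have h' := congrArg Real.log h
  rw [Real.log_prod (by intro a _; simp), Real.log_one, Fintype.sum_sum_type,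
    Fintype.sum_sum_type] at h'
  simp only [Sum.elim_inl, Sum.elim_inr, norm_conjugate] at h'
  linarith

/-- A linear functional which vanishes on the logarithms of an admissible group is zero. -/
theorem linearMap_eq_zero (f : (Fin s → ℝ) →ₗ[ℝ] ℝ)
    (h : ∀ u ∈ D.U, f (fun i => Real.log ‖D.σ (Sum.inl i) ((u : 𝓞 K) : K)‖) = 0) : f = 0 := by
  have h1 : Submodule.span ℝ (((Subgroup.toAddSubgroup D.U).map (logProj D.σ) :
    AddSubgroup (Fin s → ℝ)) : Set (Fin s → ℝ)) ≤ LinearMap.ker f := by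
    rw [Submodule.span_le]
    rintro _ ⟨u, hu, rfl⟩
    exact h u.toMul hu
  rw [D.admissible.full] at h1
  exact LinearMap.ker_eq_top.1 (top_le_iff.1 h1)

/-- If `s < t`, the non-real conjugates of the units in an admissible group cannot all have the same
absolute value. -/
theorem not_forall_norm_eq (hst : s < t)
    (h : ∀ u ∈ D.U, ∀ j k : Fin t, ‖D.σ (Sum.inr j) ((u : 𝓞 K) : K)‖ =
      ‖D.σ (Sum.inr k) ((u : 𝓞 K) : K)‖) : False := by
  classical
  let i₁ : Fin s := ⟨0, D.s_pos⟩
  let j₁ : Fin t := ⟨0, D.t_pos⟩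
  obtain ⟨π, hπ, hmul⟩ := exists_perm_embeddings (D.σ (Sum.inr j₁)) (D.σ (Sum.inl i₁))
  let c : Fin t → (K →+* ℂ) := fun j => ComplexEmbedding.conjugate (D.σ (Sum.inr j))
  -- Sends a real place to the conjugate pair that π carries onto it, with junk value `j₁` if there
  -- is none. Since s < t, some pair `j₀` is missed, so π keeps both of its members non-real.
  have hcard : ¬ Function.Surjective (fun i : Fin s => if hi : ∃ j, π (D.σ (Sum.inr j)) =
      D.σ (Sum.inl i) ∨ π (c j) = D.σ (Sum.inl i) then hi.choose else j₁) := fun hsurj => by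
    have := Fintype.card_le_of_surjective _ hsurj
    simp only [Fintype.card_fin] at this
    omega
  obtain ⟨j₀, hj₀⟩ : ∃ j₀, ∀ i, π (D.σ (Sum.inr j₀)) ≠ D.σ (Sum.inl i) ∧
      π (c j₀) ≠ D.σ (Sum.inl i) := by
    by_contra! hcon
    refine hcard fun j => ?_
    obtain ⟨i, hi⟩ : ∃ i, π (D.σ (Sum.inr j)) = D.σ (Sum.inl i) ∨ π (c j) = D.σ (Sum.inl i) := by
      obtain ⟨i, hi⟩ := hcon j
      exact ⟨i, or_iff_not_imp_left.2 hi⟩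
    have hex : ∃ j, π (D.σ (Sum.inr j)) = D.σ (Sum.inl i) ∨ π (c j) = D.σ (Sum.inl i) := ⟨j, hi⟩
    refine ⟨i, ?_⟩
    simp only [dif_pos hex]
    rcases hex.choose_spec with h1 | h1 <;> rcases hi with h2 | h2 <;>
      have h3 := π.injective (h1.trans h2.symm)
    · exact Sum.inr_injective (D.injective_σ h3)
    · exact absurd h3.symm (D.conjugate_inr_ne _ _)
    · exact absurd h3 (D.conjugate_inr_ne _ _)
    · exact D.injective_conjugate_inr h3
  let B : (𝓞 K)ˣ → ℝ := fun u => Real.log ‖D.σ (Sum.inr j₁) ((u : 𝓞 K) : K)‖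
  have hB : ∀ u ∈ D.U, ∀ φ : K →+* ℂ, (∀ i, φ ≠ D.σ (Sum.inl i)) →
      Real.log ‖φ ((u : 𝓞 K) : K)‖ = B u := by
    intro u hu φ hφ
    rcases D.exists_eq φ with ⟨i, hi⟩ | ⟨j, rfl | rfl⟩
    · exact absurd hi (hφ i)
    · simp only [B]; rw [h u hu j j₁]
    · simp only [B]; rw [norm_conjugate, h u hu j j₁]
  have hsum : ∀ u ∈ D.U, ∑ i, Real.log ‖D.σ (Sum.inl i) ((u : 𝓞 K) : K)‖ = -(2 * t * B u) := by
    intro u hu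
    have h1 := D.sum_log_norm u
    have h2 : ∑ j, Real.log ‖D.σ (Sum.inr j) ((u : 𝓞 K) : K)‖ = ∑ j : Fin t, B u :=
      Finset.sum_congr rfl fun j _ => by simp only [B]; rw [h u hu j j₁]
    rw [h2, Finset.sum_const, Finset.card_univ, Fintype.card_fin, nsmul_eq_mul] at h1
    linarith
  -- Image under π of the relation |σ_{j₁}(u)|² = |σ_{j₀}(u)|²; both factors on the right remain
  -- non-real, hence have log-norm `B u`.
  have hrel : ∀ u ∈ D.U, Real.log ‖D.σ (Sum.inl i₁) ((u : 𝓞 K) : K)‖ +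
      Real.log ‖π (c j₁) ((u : 𝓞 K) : K)‖ = 2 * B u := by
    intro u hu
    have h1 : D.σ (Sum.inr j₁) ((u : 𝓞 K) : K) * c j₁ ((u : 𝓞 K) : K) =
        D.σ (Sum.inr j₀) ((u : 𝓞 K) : K) * c j₀ ((u : 𝓞 K) : K) := by
      simp only [c, ComplexEmbedding.conjugate_coe_eq, Complex.mul_conj, Complex.normSq_eq_norm_sq]
      rw [h u hu j₁ j₀]
    have h2 := congrArg (fun z : ℂ => Real.log ‖z‖) (hmul _ _ _ _ _ h1)
    simp only [norm_mul] at h2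
    rw [Real.log_mul (by simp) (by simp), Real.log_mul (by simp) (by simp),
      hB u hu _ fun i => (hj₀ i).1, hB u hu _ fun i => (hj₀ i).2, hπ] at h2
    linarith
  have ht : (0 : ℝ) < t := by exact_mod_cast D.t_pos
  let p : Fin s → ((Fin s → ℝ) →ₗ[ℝ] ℝ) := fun i => LinearMap.proj i
  by_cases hreal : ∃ i, π (c j₁) = D.σ (Sum.inl i)
  · obtain ⟨i, hi⟩ := hreal
    have hne : i ≠ i₁ := by
      rintro rfl
      exact D.conjugate_inr_ne j₁ _ (π.injective (hi.trans hπ.symm))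
    -- With x the logarithms at the real places, `hsum` gives 2B = -(1/t)∑ x_k, so `hrel` is a
    -- linear relation in x. Its functional takes the value 1 + 1/t at the basis vector of `i₁`.
    have h0 := D.linearMap_eq_zero (p i₁ + p i + (t : ℝ)⁻¹ • ∑ k, p k) fun u hu => by
      have h1 := hrel u hu
      have h2 := hsum u hu
      rw [hi] at h1
      simp only [p, LinearMap.add_apply, LinearMap.smul_apply, LinearMap.sum_apply,
        LinearMap.proj_apply, smul_eq_mul]
      rw [h1, h2]
      field_simp
      ring
    have h1 := LinearMap.congr_fun h0 (Pi.single i₁ 1)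
    simp only [p, LinearMap.add_apply, LinearMap.smul_apply, LinearMap.sum_apply,
      LinearMap.proj_apply, smul_eq_mul, Pi.single_eq_same, Pi.single_eq_of_ne hne,
      Finset.sum_pi_single', LinearMap.zero_apply, Finset.mem_univ, if_true] at h1
    simp at h1
    have : (0 : ℝ) < (t : ℝ)⁻¹ := inv_pos.2 ht
    linarith
  -- Here the second factor is non-real, so the relation reduces to x_{i₁} = B; the functional takes
  -- the value 1 + 1/(2t) at the basis vector of `i₁`.
  · have h0 := D.linearMap_eq_zero (p i₁ + (2 * t : ℝ)⁻¹ • ∑ k, p k) fun u hu => by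
      have h1 := hrel u hu
      have h2 := hsum u hu
      rw [hB u hu _ fun i hi => hreal ⟨i, hi⟩] at h1
      simp only [p, LinearMap.add_apply, LinearMap.smul_apply, LinearMap.sum_apply,
        LinearMap.proj_apply, smul_eq_mul]
      rw [h2]
      field_simp
      linarith
    have h1 := LinearMap.congr_fun h0 (Pi.single i₁ 1)
    simp [p, Pi.single_apply] at h1
    have : (0 : ℝ) < (t : ℝ)⁻¹ := inv_pos.2 ht
    linarith

end OTData

end Embeddings

/-! ### Integrals of periodic functions over the unit cube -/

/-- The unit cube, a fundamental domain of `ℤ^ι` in `ℝ^ι`. -/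
abbrev unitCube (ι : Type*) [Fintype ι] : Set (ι → ℝ) :=
  ZSpan.fundamentalDomain (Pi.basisFun ℝ ι)

section Periodic

variable {ι : Type*} [Fintype ι] {f : (ι → ℝ) → ℝ}

theorem mem_span_basisFun_iff {x : ι → ℝ} :
    x ∈ Submodule.span ℤ (Set.range (Pi.basisFun ℝ ι)) ↔ ∃ n : ι → ℤ, x = fun i => (n i : ℝ) := by
  rw [Basis.mem_span_iff_repr_mem]
  simp only [Pi.basisFun_repr, Set.mem_range, eq_intCast]
  exact ⟨fun h => ⟨fun i => (h i).choose, funext fun i => (h i).choose_spec.symm⟩,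
    fun ⟨n, hn⟩ i => ⟨n i, by rw [hn]⟩⟩

instance : VAddInvariantMeasure (Submodule.span ℤ (Set.range (Pi.basisFun ℝ ι))) (ι → ℝ) volume :=
  inferInstanceAs <| VAddInvariantMeasure
    (Submodule.span ℤ (Set.range (Pi.basisFun ℝ ι))).toAddSubgroup (ι → ℝ) volume

/-- The translated cube is again a fundamental domain, and a periodic function has the same integral
over any two of them. -/
theorem setIntegral_unitCube_add (hf : ∀ (n : ι → ℤ) r, f ((fun i => (n i : ℝ)) + r) = f r)
    (r₀ : ι → ℝ) : ∫ r in unitCube ι, f (r₀ + r) = ∫ r in unitCube ι, f r := by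
  have h1 := ZSpan.isAddFundamentalDomain (Pi.basisFun ℝ ι) volume
  have h2 := h1.vadd_of_comm r₀
  have h3 := (measurePreserving_add_left (volume : Measure (ι → ℝ)) r₀).setIntegral_image_emb
    (measurableEmbedding_addLeft r₀) f (unitCube ι)
  rw [← h3]
  refine IsAddFundamentalDomain.setIntegral_eq (μ := volume) h2 h1 ?_
  rintro ⟨g, hg⟩ x
  obtain ⟨n, rfl⟩ := mem_span_basisFun_iff.1 hg
  exact hf n x

/-- A matrix in GL(ℤ) preserves the lattice and, having determinant ±1, the volume; it therefore
carries the cube to another fundamental domain. This is applied to multiplication by a unit. -/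
theorem setIntegral_unitCube_mulVec [DecidableEq ι]
    (hf : ∀ (n : ι → ℤ) r, f ((fun i => (n i : ℝ)) + r) = f r)
    {M : Matrix ι ι ℤ} (hM : IsUnit M) :
    ∫ r in unitCube ι, f ((M.map (Int.castRingHom ℝ)).mulVec r) = ∫ r in unitCube ι, f r := by
  obtain ⟨M, rfl⟩ := hM
  let A : (ι → ℝ) ≃ₗ[ℝ] (ι → ℝ) := LinearEquiv.ofLinearMap
    (Matrix.toLin' ((M : Matrix ι ι ℤ).map (Int.castRingHom ℝ)))
    (Matrix.toLin' ((↑(M⁻¹) : Matrix ι ι ℤ).map (Int.castRingHom ℝ)))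
    (by rw [← Matrix.toLin'_mul, ← Matrix.map_mul, Units.mul_inv]; simp)
    (by rw [← Matrix.toLin'_mul, ← Matrix.map_mul, Units.inv_mul]; simp)
  have hspan : ∀ N : Matrix ι ι ℤ, ∀ x ∈ Submodule.span ℤ (Set.range (Pi.basisFun ℝ ι)),
      (N.map (Int.castRingHom ℝ)).mulVec x ∈
        Submodule.span ℤ (Set.range (Pi.basisFun ℝ ι)) := by
    intro N x hx
    obtain ⟨n, rfl⟩ := mem_span_basisFun_iff.1 hx
    refine mem_span_basisFun_iff.2 ⟨N.mulVec n, ?_⟩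
    ext i
    simp [Matrix.mulVec, dotProduct]
  have h1 := ZSpan.isAddFundamentalDomain (Pi.basisFun ℝ ι) volume
  have hdet : |LinearMap.det (A : (ι → ℝ) →ₗ[ℝ] (ι → ℝ))| = 1 := by
    have : LinearMap.det (A : (ι → ℝ) →ₗ[ℝ] (ι → ℝ)) = ((M : Matrix ι ι ℤ).det : ℝ) := by
      change LinearMap.det (Matrix.toLin' ((M : Matrix ι ι ℤ).map (Int.castRingHom ℝ))) = _
      rw [LinearMap.det_toLin', ← RingHom.mapMatrix_apply, ← RingHom.map_det]
      simp
    rw [this]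
    have h2 := Int.isUnit_iff_abs_eq.1 ((Matrix.isUnit_iff_isUnit_det _).1 M.isUnit)
    exact_mod_cast h2
  have hAc : Continuous A := LinearMap.continuous_of_finiteDimensional _
  have hAc' : Continuous A.symm := LinearMap.continuous_of_finiteDimensional _
  have hpres : MeasurePreserving A volume volume := by
    refine ⟨hAc.measurable, ?_⟩
    have := Measure.map_linearMap_addHaar_eq_smul_addHaar (volume : Measure (ι → ℝ))
      (f := (A : (ι → ℝ) →ₗ[ℝ] (ι → ℝ))) (by intro h; rw [h] at hdet; simp at hdet)
    rw [abs_inv, hdet] at this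
    simpa using this
  let Ae : (ι → ℝ) ≃ₜ (ι → ℝ) := ⟨A.toEquiv, hAc, hAc'⟩
  have hpres' : MeasurePreserving A.symm volume volume :=
    hpres.symm (e := Ae.toMeasurableEquiv)
  have h2 := h1.image_of_equiv A.toEquiv hpres'.quasiMeasurePreserving
    (⟨fun x => ⟨A.symm x, hspan _ _ x.2⟩, fun x => ⟨A x, hspan _ _ x.2⟩,
      fun x => Subtype.ext (A.apply_symm_apply _), fun x => Subtype.ext (A.symm_apply_apply _)⟩ :
      Submodule.span ℤ (Set.range (Pi.basisFun ℝ ι)) ≃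
        Submodule.span ℤ (Set.range (Pi.basisFun ℝ ι)))
    (fun g x => by
      change A (A.symm g + x) = g + A x
      rw [map_add, A.apply_symm_apply])
  have h3 := hpres.setIntegral_image_emb Ae.toMeasurableEquiv.measurableEmbedding f (unitCube ι)
  refine h3.symm.trans ?_
  refine IsAddFundamentalDomain.setIntegral_eq (μ := volume) h2 h1 ?_
  rintro ⟨g, hg⟩ x
  obtain ⟨n, rfl⟩ := mem_span_basisFun_iff.1 hg
  exact hf n x

end Periodic

/-! ### Averaging a function along a lattice -/

section Average

variable {ι : Type*} [Fintype ι] {E : Type*} [NormedAddCommGroup E] [NormedSpace ℝ E]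
  {Ω : Set E} {T : (ι → ℝ) →L[ℝ] E} {f : E → ℝ}

theorem integrableOn_unitCube {g : (ι → ℝ) → ℝ} (hg : Continuous g) :
    IntegrableOn g (unitCube ι) :=
  (hg.continuousOn.integrableOn_compact
    (ZSpan.fundamentalDomain_isBounded (Pi.basisFun ℝ ι)).isCompact_closure).mono_set
    subset_closure

/-- Differentiation of `z ↦ ∫ f (T r + z)` under the integral sign. -/
theorem hasDerivAt_setIntegral_unitCube (hΩ : IsOpen Ω) (hT : ∀ z ∈ Ω, ∀ r, T r + z ∈ Ω)
    (hf : ContDiffOn ℝ 1 f Ω) {z : E} (hz : z ∈ Ω) (v : E) :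
    HasDerivAt (fun τ : ℝ => ∫ r in unitCube ι, f (T r + (z + τ • v)))
      (∫ r in unitCube ι, fderiv ℝ f (T r + z) v) 0 := by
  have hline : ContinuousAt (fun τ : ℝ => z + τ • v) 0 := by fun_prop
  obtain ⟨ε, hε, hball⟩ := Metric.nhds_basis_closedBall.mem_iff.1
    (hline.preimage_mem_nhds (hΩ.mem_nhds (by simpa using hz)))
  have hball' : ∀ τ ∈ Metric.closedBall (0 : ℝ) ε, z + τ • v ∈ Ω := fun τ hτ => hball hτ
  have hf' : ContinuousOn (fderiv ℝ f) Ω := hf.continuousOn_fderiv_of_isOpen hΩ le_rfl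
  have hcont : ∀ w ∈ Ω, Continuous fun r => f (T r + w) := fun w hw =>
    hf.continuousOn.comp_continuous (by fun_prop) fun r => hT w hw r
  have hcont' : ∀ w ∈ Ω, Continuous fun r => fderiv ℝ f (T r + w) v := fun w hw =>
    (hf'.comp_continuous (by fun_prop) fun r => hT w hw r).clm_apply continuous_const
  have hK : IsCompact (Metric.closedBall (0 : ℝ) ε ×ˢ closure (unitCube ι)) :=
    (isCompact_closedBall _ _).prod
      (ZSpan.fundamentalDomain_isBounded (Pi.basisFun ℝ ι)).isCompact_closure
  -- Compactness of interval times closed cube gives the constant dominating function.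
  obtain ⟨C, hC⟩ := hK.exists_bound_of_continuousOn
    (f := fun p : ℝ × (ι → ℝ) => fderiv ℝ f (T p.2 + (z + p.1 • v)) v)
    ((hf'.comp (by fun_prop) fun p hp => hT _ (hball' _ hp.1) _).clm_apply continuousOn_const)
  have h := hasDerivAt_integral_of_dominated_loc_of_deriv_le (𝕜 := ℝ)
    (μ := volume.restrict (unitCube ι)) (bound := fun _ => C) (x₀ := (0 : ℝ))
    (F := fun τ r => f (T r + (z + τ • v)))
    (F' := fun τ r => fderiv ℝ f (T r + (z + τ • v)) v) (Metric.closedBall_mem_nhds 0 hε)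
    (Filter.mem_of_superset (Metric.closedBall_mem_nhds 0 hε) fun τ hτ =>
      (hcont _ (hball' τ hτ)).aestronglyMeasurable)
    (integrableOn_unitCube (hcont _ (by simpa using hz)))
    (hcont' _ (by simpa using hz)).aestronglyMeasurable ?_ ?_ ?_
  · simpa using h.2
  · filter_upwards [ae_restrict_mem (ZSpan.fundamentalDomain_measurableSet (Pi.basisFun ℝ ι))]
      with r hr τ hτ
    exact hC (τ, r) ⟨hτ, subset_closure hr⟩
  · exact integrableOn_unitCube continuous_const
  · refine Filter.Eventually.of_forall fun r τ hτ => ?_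
    have hmem := hT _ (hball' τ hτ) r
    have h1 : HasFDerivAt f (fderiv ℝ f (T r + (z + τ • v))) (T r + (z + τ • v)) :=
      ((hf.contDiffAt (hΩ.mem_nhds hmem)).differentiableAt one_ne_zero).hasFDerivAt
    have h2 : HasDerivAt (fun τ : ℝ => T r + (z + τ • v)) v τ := by
      simpa using (((hasDerivAt_id τ).smul_const v).const_add z).const_add (T r)
    exact h1.comp_hasDerivAt τ h2

/-- Moving along `T r₀` only shifts the integration variable, which leaves the average unchanged;
its derivative in that direction is therefore 0. -/
theorem setIntegral_fderiv_periodic (hΩ : IsOpen Ω) (hT : ∀ z ∈ Ω, ∀ r, T r + z ∈ Ω)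
    (hf : ContDiffOn ℝ 1 f Ω)
    (hper : ∀ z ∈ Ω, ∀ n : ι → ℤ, f (T (fun i => (n i : ℝ)) + z) = f z)
    {z : E} (hz : z ∈ Ω) (r₀ : ι → ℝ) :
    ∫ r in unitCube ι, fderiv ℝ f (T r + z) (T r₀) = 0 := by
  refine (hasDerivAt_setIntegral_unitCube hΩ hT hf hz (T r₀)).unique ?_
  have h : ∀ τ : ℝ, ∫ r in unitCube ι, f (T r + (z + τ • T r₀)) =
      ∫ r in unitCube ι, f (T r + z) := by
    intro τ
    rw [← setIntegral_unitCube_add (f := fun r => f (T r + z)) _ (τ • r₀)]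
    · simp only [map_add, map_smul]
      congr 1 with r
      congr 1
      abel
    · intro n r
      rw [map_add, add_assoc]
      exact hper _ (hT z hz r) n
  simp only [h]
  exact hasDerivAt_const _ _

theorem setIntegral_unitCube_eq (hΩ : IsOpen Ω) (hconv : Convex ℝ Ω)
    (hT : ∀ z ∈ Ω, ∀ r, T r + z ∈ Ω) (hf : ContDiffOn ℝ 1 f Ω)
    (hder : ∀ z ∈ Ω, ∀ v, ∫ r in unitCube ι, fderiv ℝ f (T r + z) v = 0)
    {z w : E} (hz : z ∈ Ω) (hw : w ∈ Ω) :
    ∫ r in unitCube ι, f (T r + w) = ∫ r in unitCube ι, f (T r + z) := by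
  let G : ℝ → ℝ := fun τ => ∫ r in unitCube ι, f (T r + (z + τ • (w - z)))
  have hG : ∀ τ ∈ Set.Icc (0 : ℝ) 1, HasDerivAt G 0 τ := by
    intro τ hτ
    have hmem : z + τ • (w - z) ∈ Ω := hconv.add_smul_sub_mem hz hw hτ
    have h1 := hasDerivAt_setIntegral_unitCube hΩ hT hf hmem (w - z)
    rw [hder _ hmem] at h1
    have h2 := HasDerivAt.comp_sub_const τ τ (by rw [sub_self]; exact h1)
    refine h2.congr_of_eventuallyEq (Filter.Eventually.of_forall fun x => ?_)
    simp only [G]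
    congr 1 with r
    congr 2
    module
  have := constant_of_has_deriv_right_zero (fun τ hτ => (hG τ hτ).continuousAt.continuousWithinAt)
    (fun τ hτ => (hG τ (Set.Ico_subset_Icc_self hτ)).hasDerivWithinAt) 1 (by simp)
  simpa [G] using this

end Average

/-! ### The lattice of integers and characters of the group -/

namespace OTData

variable {K : Type*} [Field K] [NumberField K] {s t : ℕ} (D : OTData K s t)

section Lattice

/-- The real linear map sending the standard lattice to the image of `𝓞 K` in `ℂ^s × ℂ^t`. -/
noncomputable def latticeMap : (Free.ChooseBasisIndex ℤ (𝓞 K) → ℝ) →L[ℝ] OTModel s t :=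
  ∑ k, (ContinuousLinearMap.proj (R := ℝ) (φ := fun _ => ℝ) k).smulRight
    (fun i => D.σ i (RingOfIntegers.basis K k : K) : OTModel s t)

theorem latticeMap_apply (r : Free.ChooseBasisIndex ℤ (𝓞 K) → ℝ) (i : Fin s ⊕ Fin t) :
    D.latticeMap r i = ∑ k, (r k : ℂ) * D.σ i (RingOfIntegers.basis K k : K) := by
  simp [latticeMap]

theorem latticeMap_intCast (n : Free.ChooseBasisIndex ℤ (𝓞 K) → ℤ) (i : Fin s ⊕ Fin t) :
    D.latticeMap (fun k => (n k : ℝ)) i =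
      D.σ i ((∑ k, n k • RingOfIntegers.basis K k : 𝓞 K) : K) := by
  simp [latticeMap_apply]

theorem latticeMap_add_mem {z : OTModel s t} (hz : z ∈ OTDomain s t)
    (r : Free.ChooseBasisIndex ℤ (𝓞 K) → ℝ) : D.latticeMap r + z ∈ OTDomain s t := fun i => by
  have : (D.latticeMap r (Sum.inl i)).im = 0 := by
    simp [latticeMap_apply, Complex.mul_im, D.real_im]
  simpa [this] using hz i

/-- An integral basis of K is a ℂ-basis of the functions on all embeddings, so the function
supported at σ_{s+j} has complex coordinates. Twice their real parts work because no conjugate of a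
listed embedding equals σ_{s+j}. -/
theorem exists_latticeMap_eq_single (j : Fin t) (c : ℂ) :
    ∃ r, D.latticeMap r = Pi.single (Sum.inr j) c := by
  classical
  let x : (K →+* ℂ) → ℂ := Pi.single (D.σ (Sum.inr j)) c
  let cs := (canonicalEmbedding.latticeBasis K).repr x
  have hcs : ∀ φ : K →+* ℂ, ∑ k, cs k * φ (RingOfIntegers.basis K k : K) = x φ := by
    intro φ
    have h := congrFun ((canonicalEmbedding.latticeBasis K).sum_repr x) φ
    simpa [canonicalEmbedding.latticeBasis_apply, integralBasis_apply,
      canonicalEmbedding.apply_at] using h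
  refine ⟨fun k => 2 * (cs k).re, funext fun i => ?_⟩
  have h1 : ∀ k, ((2 * (cs k).re : ℝ) : ℂ) * D.σ i (RingOfIntegers.basis K k : K) =
      cs k * D.σ i (RingOfIntegers.basis K k : K) + (starRingEnd ℂ) (cs k *
        ComplexEmbedding.conjugate (D.σ i) (RingOfIntegers.basis K k : K)) := by
    intro k
    have h2 : ((2 * (cs k).re : ℝ) : ℂ) = cs k + (starRingEnd ℂ) (cs k) := by
      rw [Complex.add_conj]
    rw [h2, map_mul, ComplexEmbedding.conjugate_coe_eq, Complex.conj_conj]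
    ring
  rw [latticeMap_apply, Finset.sum_congr rfl fun k _ => h1 k, Finset.sum_add_distrib, ← map_sum,
    hcs, hcs]
  have h3 : x (ComplexEmbedding.conjugate (D.σ i)) = 0 := by
    refine Pi.single_eq_of_ne (fun h => ?_) _
    rcases i with i | k
    · rw [D.conjugate_inl] at h
      exact Sum.inl_ne_inr (D.injective_σ h)
    · exact D.conjugate_inr_ne _ _ h
  rw [h3, map_zero, add_zero]
  simp only [x, Pi.single_apply, D.injective_σ.eq_iff]

theorem latticeMap_mulVec (u : 𝓞 K) (r : Free.ChooseBasisIndex ℤ (𝓞 K) → ℝ) (i : Fin s ⊕ Fin t) :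
    D.latticeMap (((Algebra.leftMulMatrix (RingOfIntegers.basis K) u).map
      (Int.castRingHom ℝ)).mulVec r) i = D.σ i (u : K) * D.latticeMap r i := by
  have h : ∀ k, D.σ i (u : K) * D.σ i (RingOfIntegers.basis K k : K) =
      ∑ l, (Algebra.leftMulMatrix (RingOfIntegers.basis K) u l k : ℂ) *
        D.σ i (RingOfIntegers.basis K l : K) := by
    intro k
    have h1 := (RingOfIntegers.basis K).sum_repr (u * RingOfIntegers.basis K k)
    have h2 := congrArg (fun a : 𝓞 K => D.σ i (a : K)) h1
    simp only [map_sum, map_mul, zsmul_eq_mul, map_intCast] at h2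
    simp only [Algebra.leftMulMatrix_eq_repr_mul]
    exact h2.symm
  simp only [latticeMap_apply, Matrix.mulVec, dotProduct, Matrix.map_apply, Complex.ofReal_sum,
    Finset.sum_mul, Finset.mul_sum]
  rw [Finset.sum_comm]
  refine Finset.sum_congr rfl fun k _ => ?_
  rw [mul_left_comm, h k, Finset.mul_sum]
  refine Finset.sum_congr rfl fun l _ => ?_
  simp
  ring

theorem exists_ne_one : ∃ u ∈ D.U, u ≠ 1 := by
  by_contra! h
  have : Subsingleton (Additive D.U) :=
    ⟨fun a b => Subtype.ext ((h _ a.toMul.2).trans (h _ b.toMul.2).symm)⟩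
  have h1 := D.admissible.rank_eq
  rw [Module.finrank_zero_of_subsingleton] at h1
  exact D.s_pos.ne h1

/-- A positive character of `U ⋉ 𝓞 K` is trivial on the translations. -/
theorem character_translation (χ : D.Γ →* ℝ) (hχ : ∀ g, 0 < χ g) (a : 𝓞 K) :
    χ (SemidirectProduct.inl (Multiplicative.ofAdd a)) = 1 := by
  let f : 𝓞 K →+ ℝ :=
    { toFun := fun a => Real.log (χ (SemidirectProduct.inl (Multiplicative.ofAdd a)))
      map_zero' := by simp
      map_add' := fun a b => by
        rw [ofAdd_add, map_mul, map_mul, Real.log_mul (hχ _).ne' (hχ _).ne'] }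
  obtain ⟨u, hu, hu1⟩ := D.exists_ne_one
  -- Multiplication by u is conjugation in the semidirect product, invisible to a character. Thus f
  -- kills (u - 1)𝓞 K, which contains a nonzero integer, and ℝ is torsion-free.
  have hf : ∀ a : 𝓞 K, f ((u : 𝓞 K) * a) = f a := by
    intro a
    have h1 := SemidirectProduct.inl_aut (φ := D.unitAction) ⟨u, hu⟩ (Multiplicative.ofAdd a)
    have h2 : D.unitAction ⟨u, hu⟩ (Multiplicative.ofAdd a) =
      Multiplicative.ofAdd ((u : 𝓞 K) * a) := rfl
    rw [h2] at h1
    have h3 : χ (SemidirectProduct.inr (⟨u, hu⟩ : D.U)) *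
        χ (SemidirectProduct.inr (⟨u, hu⟩⁻¹ : D.U)) = 1 := by
      rw [← map_mul, ← map_mul, mul_inv_cancel, map_one, map_one]
    change Real.log (χ _) = Real.log (χ _)
    rw [h1, map_mul, map_mul, mul_right_comm, h3, one_mul]
  have hmem := Ideal.absNorm_mem (Ideal.span {(u : 𝓞 K) - 1})
  obtain ⟨c, hc⟩ := Ideal.mem_span_singleton'.1 hmem
  have hN : Ideal.absNorm (Ideal.span {(u : 𝓞 K) - 1}) ≠ 0 := by
    rw [Ne, Ideal.absNorm_eq_zero_iff, Ideal.span_singleton_eq_bot, sub_eq_zero]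
    exact fun h => hu1 (Units.ext h)
  have h1 : Ideal.absNorm (Ideal.span {(u : 𝓞 K) - 1}) • f a = 0 := by
    rw [← map_nsmul, nsmul_eq_mul, ← hc,
      show c * ((u : 𝓞 K) - 1) * a = (u : 𝓞 K) * (c * a) - c * a by ring, map_sub, hf, sub_self]
  have h2 : f a = 0 := (smul_eq_zero.1 h1).resolve_left hN
  exact Real.eq_one_of_pos_of_log_eq_zero (hχ _) h2

end Lattice

/-! ### Linear parts of the action and forms on complex lines -/

/-- The linear part of the affine map `D.affine g`. -/
def linearPart (g : D.Γ) (v : OTModel s t) : OTModel s t :=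
  fun i => D.σ i (((g.right : (𝓞 K)ˣ) : 𝓞 K) : K) * v i

theorem linearPart_ne_zero (g : D.Γ) {v : OTModel s t} (hv : v ≠ 0) : D.linearPart g v ≠ 0 := by
  obtain ⟨i, hi⟩ := Function.ne_iff.1 hv
  exact Function.ne_iff.2 ⟨i, mul_ne_zero (by simp) hi⟩

theorem linearPart_smul (g : D.Γ) (c : ℂ) (v : OTModel s t) :
    D.linearPart g (c • v) = c • D.linearPart g v :=
  funext fun _ => mul_left_comm _ _ _

theorem linearPart_mul (g h : D.Γ) (v : OTModel s t) :
    D.linearPart (g * h) v = D.linearPart g (D.linearPart h v) := by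
  funext i
  simp [linearPart, mul_assoc]

theorem affine_mul (g h : D.Γ) {z : OTModel s t} (hz : z ∈ OTDomain s t) :
    D.affine (g * h) z = D.affine g (D.affine h z) :=
  congrArg Subtype.val (mul_smul g h (⟨z, hz⟩ : OTDomain s t))

theorem convex_domain (s t : ℕ) : Convex ℝ (OTDomain s t : Set (OTModel s t)) := by
  intro x hx y hy a b ha hb hab i
  have hx' := hx i
  have hy' := hy i
  simp only [Pi.add_apply, Pi.smul_apply, Complex.add_im, Complex.smul_im, smul_eq_mul]
  rcases ha.eq_or_lt with rfl | ha
  · rw [zero_add] at hab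
    simpa [hab] using hy'
  · positivity

end OTData

/-- On the real plane spanned by e and i·e, multiplication by c has determinant |c|², and an
alternating 2-form scales by the determinant. -/
theorem ContinuousAlternatingMap.apply_smul_smul_I {E : Type*} [NormedAddCommGroup E]
    [NormedSpace ℂ E] (η : E [⋀^Fin 2]→L[ℝ] ℝ) (c : ℂ) (e : E) :
    η ![c • e, Complex.I • c • e] = ‖c‖ ^ 2 * η ![e, Complex.I • e] := by
  have h1 : c • e = c.re • e + c.im • (Complex.I • e) := by
    conv_lhs => rw [← Complex.re_add_im c]
    rw [add_smul, mul_smul, Complex.coe_smul, Complex.coe_smul]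
  have h2 : Complex.I • c • e = c.re • (Complex.I • e) - c.im • e := by
    rw [h1, smul_add, smul_comm _ c.re, smul_comm _ c.im, smul_smul, Complex.I_mul_I]
    module
  have hu0 : ∀ a b c : E, Function.update ![a, b] 0 c = ![c, b] := fun a b c => by
    funext i; fin_cases i <;> rfl
  have hu1 : ∀ a b c : E, Function.update ![a, b] 1 c = ![a, c] := fun a b c => by
    funext i; fin_cases i <;> rfl
  have hadd : ∀ a b c : E, η ![a + b, c] = η ![a, c] + η ![b, c] := fun a b c => by
    have := η.map_update_add ![a, c] 0 a b
    rwa [hu0, hu0, hu0] at this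
  have hadd' : ∀ a b c : E, η ![c, a + b] = η ![c, a] + η ![c, b] := fun a b c => by
    have := η.map_update_add ![c, a] 1 a b
    rwa [hu1, hu1, hu1] at this
  have hsmul : ∀ (r : ℝ) (a b : E), η ![r • a, b] = r * η ![a, b] := fun r a b => by
    have := η.map_update_smul ![a, b] 0 r a
    rwa [hu0, hu0] at this
  have hsmul' : ∀ (r : ℝ) (a b : E), η ![a, r • b] = r * η ![a, b] := fun r a b => by
    have := η.map_update_smul ![a, b] 1 r b
    rwa [hu1, hu1] at this
  have hself : ∀ a : E, η ![a, a] = 0 := fun a =>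
    η.map_eq_zero_of_eq ![a, a] (i := 0) (j := 1) rfl (by decide)
  have hswap : η ![Complex.I • e, e] = - η ![e, Complex.I • e] := by
    have := hself (e + Complex.I • e)
    rw [hadd, hadd', hadd', hself, hself] at this
    linarith
  rw [h2, h1, sub_eq_add_neg, ← neg_smul, hadd, hadd', hadd']
  simp only [hsmul, hsmul', hself, hswap]
  rw [← Complex.normSq_eq_norm_sq, Complex.normSq_apply]
  ring

/-! ### Homothety factors of an invariant-up-to-scale closed form -/

namespace OTData

variable {K : Type*} [Field K] [NumberField K] {s t : ℕ} (D : OTData K s t)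
  {η : OTModel s t → OTModel s t [⋀^Fin 2]→L[ℝ] ℝ}

/-- The homothety factors of a positive form which is homothetic under `U ⋉ 𝓞 K` form a positive
character. -/
theorem exists_character
    (hpos : ∀ z ∈ OTDomain s t, ∀ v, v ≠ 0 → 0 < η z ![v, Complex.I • v])
    (hη : ∀ g : D.Γ, ∃ χ : ℝ, ∀ z ∈ OTDomain s t, ∀ v w,
      η (D.affine g z) ![D.linearPart g v, D.linearPart g w] = χ * η z ![v, w]) :
    ∃ χ : D.Γ →* ℝ, (∀ g, 0 < χ g) ∧ ∀ g, ∀ z ∈ OTDomain s t, ∀ v w,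
      η (D.affine g z) ![D.linearPart g v, D.linearPart g w] = χ g * η z ![v, w] := by
  choose χ hχ using hη
  obtain ⟨z, hz⟩ := domain_nonempty (s := s) (t := t)
  let e : OTModel s t := Pi.single (Sum.inr ⟨0, D.t_pos⟩) 1
  have he : e ≠ 0 := by simp [e]
  -- One nonzero value of the form determines each factor by cancellation, which forces
  -- multiplicativity.
  have hq := hpos z hz e he
  have hone : χ 1 = 1 := by
    have h1 := hχ 1 z hz e (Complex.I • e)
    have h2 : D.affine 1 z = z := congrArg Subtype.val (one_smul D.Γ (⟨z, hz⟩ : OTDomain s t))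
    have h3 : ∀ v, D.linearPart 1 v = v := fun v => funext fun i => by simp [linearPart]
    rw [h2, h3, h3] at h1
    exact (mul_eq_right₀ hq.ne').1 h1.symm
  have hmul : ∀ g h, χ (g * h) = χ g * χ h := by
    intro g h
    have h1 := hχ (g * h) z hz e (Complex.I • e)
    rw [D.affine_mul g h hz, linearPart_mul, linearPart_mul, hχ g _ (D.affine_mem h hz),
      hχ h z hz, ← mul_assoc] at h1
    exact (mul_right_cancel₀ hq.ne' h1).symm
  refine ⟨⟨⟨χ, hone⟩, hmul⟩, fun g => ?_, hχ⟩
  have h1 := hχ g z hz e (Complex.I • e)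
  rw [linearPart_smul] at h1
  exact pos_of_mul_pos_left (h1 ▸ hpos _ (D.affine_mem g hz) _ (D.linearPart_ne_zero g he)) hq.le

/-- Averaging over `𝓞 K` the coefficients of a positive closed form on `ℍ^s × ℂ^t` which is
homothetic under `U ⋉ 𝓞 K` determines the homothety factors. -/
theorem norm_sq_eq_character (hdiff : ∀ z ∈ OTDomain s t, DifferentiableAt ℝ η z)
    (hsmooth : ∀ v, ContDiffOn ℝ 1 (fun z => η z v) (OTDomain s t))
    (hclosed : ∀ z ∈ OTDomain s t, extDeriv η z = 0)
    (hpos : ∀ z ∈ OTDomain s t, ∀ v, v ≠ 0 → 0 < η z ![v, Complex.I • v])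
    {χ : D.Γ →* ℝ} (hχ : ∀ g, 0 < χ g)
    (hη : ∀ g, ∀ z ∈ OTDomain s t, ∀ v w,
      η (D.affine g z) ![D.linearPart g v, D.linearPart g w] = χ g * η z ![v, w])
    (u : D.U) (j : Fin t) :
    ‖D.σ (Sum.inr j) (((u : (𝓞 K)ˣ) : 𝓞 K) : K)‖ ^ 2 = χ (SemidirectProduct.inr u) := by
  classical
  let e : OTModel s t := Pi.single (Sum.inr j) 1
  have he : e ≠ 0 := by simp [e]
  let F : OTModel s t → OTModel s t → OTModel s t → ℝ := fun v w z => η z ![v, w]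
  have hΩ := (OTDomain s t).isOpen
  have hT : ∀ z ∈ OTDomain s t, ∀ r, D.latticeMap r + z ∈ OTDomain s t :=
    fun z hz r => D.latticeMap_add_mem hz r
  have hF : ∀ v w, ContDiffOn ℝ 1 (F v w) (OTDomain s t) := fun v w =>
    hsmooth ![v, w]
  have hper : ∀ v w, ∀ z ∈ OTDomain s t, ∀ n : Free.ChooseBasisIndex ℤ (𝓞 K) → ℤ,
      F v w (D.latticeMap (fun i => (n i : ℝ)) + z) = F v w z := by
    intro v w z hz n
    have h1 := hη (SemidirectProduct.inl (Multiplicative.ofAdd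
      (∑ k, n k • RingOfIntegers.basis K k))) z hz v w
    have h2 : ∀ (a : 𝓞 K) v,
        D.linearPart (SemidirectProduct.inl (Multiplicative.ofAdd a)) v = v := fun a v =>
      funext fun i => by simp [linearPart]
    rw [D.character_translation χ hχ, one_mul, h2, h2] at h1
    refine Eq.trans (congrArg (fun x => η x ![v, w]) (funext fun i => ?_)) h1
    rw [Pi.add_apply, latticeMap_intCast, add_comm]
    simp only [affine, SemidirectProduct.right_inl, SemidirectProduct.left_inl, OneMemClass.coe_one,
      Units.val_one, map_one, one_mul, toAdd_ofAdd]
  have hint : ∀ v w x, ∀ z ∈ OTDomain s t, IntegrableOn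
      (fun r => fderiv ℝ (F v w) (D.latticeMap r + z) x) (unitCube _) := fun v w x z hz =>
    integrableOn_unitCube ((((hF v w).continuousOn_fderiv_of_isOpen hΩ le_rfl).comp_continuous
      (by fun_prop) fun r => hT z hz r).clm_apply continuous_const)
  have hder : ∀ z ∈ OTDomain s t, ∀ v, ∫ r in unitCube _,
      fderiv ℝ (F e (Complex.I • e)) (D.latticeMap r + z) v = 0 := by
    intro z hz v
    -- Closedness evaluated on (v, e, i·e) trades the arbitrary direction v for e and i·e, both in
    -- the real span of 𝓞 K, where derivatives average to zero.
    have h1 : ∀ x ∈ OTDomain s t, fderiv ℝ (F e (Complex.I • e)) x v =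
        fderiv ℝ (F v (Complex.I • e)) x e - fderiv ℝ (F v e) x (Complex.I • e) := by
      intro x hx
      have h2 := extDeriv_apply (hdiff x hx) ![v, e, Complex.I • e]
      rw [hclosed x hx, Fin.sum_univ_three] at h2
      have h3 : (0 : Fin 3).removeNth ![v, e, Complex.I • e] = ![e, Complex.I • e] := by
        funext i; fin_cases i <;> rfl
      have h4 : (1 : Fin 3).removeNth ![v, e, Complex.I • e] = ![v, Complex.I • e] := by
        funext i; fin_cases i <;> rfl
      have h5 : (2 : Fin 3).removeNth ![v, e, Complex.I • e] = ![v, e] := by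
        funext i; fin_cases i <;> rfl
      rw [h3, h4, h5] at h2
      simp at h2
      simp only [F]
      linarith
    obtain ⟨r₁, hr₁⟩ := D.exists_latticeMap_eq_single j 1
    obtain ⟨r₂, hr₂⟩ := D.exists_latticeMap_eq_single j Complex.I
    have hr₂' : D.latticeMap r₂ = Complex.I • e := by
      rw [hr₂, ← Pi.single_smul, smul_eq_mul, mul_one]
    simp only [fun r => h1 _ (hT z hz r)]
    rw [integral_sub (hint _ _ _ z hz) (hint _ _ _ z hz), ← hr₂', ← show D.latticeMap r₁ = e from hr₁,
      setIntegral_fderiv_periodic hΩ hT (hF _ _) (hper _ _) hz,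
      setIntegral_fderiv_periodic hΩ hT (hF _ _) (hper _ _) hz, sub_zero]
  let G := F e (Complex.I • e)
  have hGpos : ∀ z ∈ OTDomain s t, 0 < G z := fun z hz => hpos z hz e he
  have hGc : ∀ z ∈ OTDomain s t, Continuous fun r => G (D.latticeMap r + z) := fun z hz =>
    (hF _ _).continuousOn.comp_continuous (by fun_prop) fun r => hT z hz r
  obtain ⟨z, hz⟩ := domain_nonempty (s := s) (t := t)
  have hw := D.affine_mem (SemidirectProduct.inr u) hz
  have hIpos : 0 < ∫ r in unitCube _, G (D.latticeMap r + z) := by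
    rw [setIntegral_pos_iff_support_of_nonneg_ae
      (Filter.Eventually.of_forall fun r => (hGpos _ (hT z hz r)).le)
      (integrableOn_unitCube (hGc z hz))]
    rw [Function.support_eq_univ fun r => (hGpos _ (hT z hz r)).ne', Set.univ_inter]
    exact pos_iff_ne_zero.2 (ZSpan.measure_fundamentalDomain_ne_zero _)
  have hconst := setIntegral_unitCube_eq hΩ (convex_domain s t) hT (hF e (Complex.I • e)) hder hz hw
  have hlin : D.linearPart (SemidirectProduct.inr u) e =
      D.σ (Sum.inr j) (((u : (𝓞 K)ˣ) : 𝓞 K) : K) • e := by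
    funext i
    by_cases hi : i = Sum.inr j
    · subst hi; simp [linearPart, e]
    · simp [linearPart, e, hi]
  -- The unit acts on the averaging variable r by an invertible integer matrix, so integrating this
  -- identity compares the averages of G at z and at u·z, which agree.
  have htrans : ∀ r, ‖D.σ (Sum.inr j) (((u : (𝓞 K)ˣ) : 𝓞 K) : K)‖ ^ 2 *
      G (D.latticeMap (((Algebra.leftMulMatrix (RingOfIntegers.basis K) ((u : (𝓞 K)ˣ) : 𝓞 K)).map
        (Int.castRingHom ℝ)).mulVec r) + D.affine (SemidirectProduct.inr u) z) =
      χ (SemidirectProduct.inr u) * G (D.latticeMap r + z) := by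
    intro r
    have h1 := hη (SemidirectProduct.inr u) _ (hT z hz r) e (Complex.I • e)
    rw [linearPart_smul, hlin, ContinuousAlternatingMap.apply_smul_smul_I] at h1
    refine Eq.trans (congrArg (fun x => _ * G x) ?_) h1
    funext i
    rw [Pi.add_apply, latticeMap_mulVec]
    simp only [affine, SemidirectProduct.right_inr, SemidirectProduct.left_inr, toAdd_one,
      map_zero, add_zero, Pi.add_apply, mul_add]
  have hM : IsUnit (Algebra.leftMulMatrix (RingOfIntegers.basis K) ((u : (𝓞 K)ˣ) : 𝓞 K)) :=
    (Units.isUnit (u : (𝓞 K)ˣ)).map _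
  have hI := setIntegral_unitCube_mulVec
    (f := fun r => G (D.latticeMap r + D.affine (SemidirectProduct.inr u) z)) (fun n r => by
      rw [map_add, add_assoc]
      exact hper _ _ _ (hT _ hw r) n) hM
  have hfin := congrArg (fun φ : (Free.ChooseBasisIndex ℤ (𝓞 K) → ℝ) → ℝ =>
    ∫ r in unitCube _, φ r) (funext htrans)
  simp only [integral_const_mul] at hfin
  rw [hI, hconst] at hfin
  exact mul_right_cancel₀ hIpos.ne' hfin

end OTData

/-! ### Pull-backs of forms and of the Kähler conditions -/

section Pullback

variable {E : Type*} [NormedAddCommGroup E] [NormedSpace ℂ E]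
  {W Y Z : Type*} [TopologicalSpace W] [ChartedSpace E W] [TopologicalSpace Y] [ChartedSpace E Y]
  [TopologicalSpace Z] [ChartedSpace E Z]

theorem TwoForm.pullback_congr {f g : Y → Z} (η : TwoForm E Z) {y : Y} (h : f =ᶠ[𝓝 y] g) :
    TwoForm.pullback f η y = TwoForm.pullback g η y := by
  -- All tangent spaces are E; fixing this type lets the value and the derivative be replaced
  -- simultaneously.
  let Ψ : Z → (E →L[ℂ] E) → E [⋀^Fin 2]→L[ℝ] ℝ := fun z A =>
    ContinuousAlternatingMap.compContinuousLinearMap (M' := E) (η z) (A.restrictScalars ℝ)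
  exact congrArg₂ Ψ h.eq_of_nhds (h.mfderiv_eq (I := 𝓘(ℂ, E)) (I' := 𝓘(ℂ, E)))

theorem TwoForm.pullback_comp {f : W → Y} {g : Y → Z} (η : TwoForm E Z) {x : W}
    (hg : MDifferentiableAt 𝓘(ℂ, E) 𝓘(ℂ, E) g (f x))
    (hf : MDifferentiableAt 𝓘(ℂ, E) 𝓘(ℂ, E) f x) :
    TwoForm.pullback (g ∘ f) η x = TwoForm.pullback f (TwoForm.pullback g η) x := by
  unfold TwoForm.pullback
  rw [mfderiv_comp x hg hf]
  rfl

theorem TwoForm.pullback_model {k : E → E} (η : E → E [⋀^Fin 2]→L[ℝ] ℝ) {z : E}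
    (hk : DifferentiableAt ℂ k z) : TwoForm.pullback (Y := E) (Z := E) k η z =
      (η (k z)).compContinuousLinearMap (fderiv ℝ k z) := by
  rw [hk.fderiv_restrictScalars ℝ]
  unfold TwoForm.pullback
  rw [mfderiv_eq_fderiv]
  rfl

theorem TwoForm.pullback_apply (f : Y → Z) (η : TwoForm E Z) (y : Y)
    (v w : TangentSpace 𝓘(ℂ, E) y) : TwoForm.pullback f η y ![v, w] =
      η (f y) ![mfderiv 𝓘(ℂ, E) 𝓘(ℂ, E) f y v, mfderiv 𝓘(ℂ, E) 𝓘(ℂ, E) f y w] := by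
  refine congrArg (η (f y)) ?_
  funext i
  fin_cases i <;> rfl

/-- A continuous lift of a holomorphic map through a local biholomorphism is holomorphic. -/
theorem ContMDiffAt.of_comp_isLocalDiffeomorph {p : Y → Z} {q : W → Y} {f : W → Z} {x : W}
    (hp : IsLocalDiffeomorph 𝓘(ℂ, E) 𝓘(ℂ, E) ω p) (hq : ContinuousAt q x)
    (hf : ContMDiffAt 𝓘(ℂ, E) 𝓘(ℂ, E) ω f x) (hpq : p ∘ q =ᶠ[𝓝 x] f) :
    ContMDiffAt 𝓘(ℂ, E) 𝓘(ℂ, E) ω q x := by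
  have h := hp (q x)
  have h1 : ∀ᶠ x' in 𝓝 x, q x' = (h.localInverse ∘ f) x' := by
    filter_upwards [hpq, hq.preimage_mem_nhds
      (h.localInverse.open_target.mem_nhds h.localInverse_mem_target)] with x' h2 h3
    rw [Function.comp_apply, ← h2, Function.comp_apply, h.localInverse_left_inv h3]
  refine ContMDiffAt.congr_of_eventuallyEq ?_ h1
  refine ContMDiffAt.comp x ?_ hf
  rw [← hpq.eq_of_nhds]
  exact h.localInverse_contMDiffAt

theorem TwoForm.IsKahler.contDiffAt_inChart {η : TwoForm E Y} (hη : η.IsKahler) (y : Y) :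
    ContDiffAt ℝ ∞ (η.inChart (chartAt E y)) (chartAt E y y) :=
  (hη.smooth _ (chart_mem_atlas E y)).contDiffAt
    ((chartAt E y).open_target.mem_nhds (mem_chart_target E y))

theorem TwoForm.IsKahler.pullback_pos {η : TwoForm E Y} {Q : E → Y} (hη : η.IsKahler) {z : E}
    (hinj : Function.Injective (mfderiv 𝓘(ℂ, E) 𝓘(ℂ, E) Q z)) {v : E} (hv : v ≠ 0) :
    0 < (TwoForm.pullback (Y := E) Q η z : E [⋀^Fin 2]→L[ℝ] ℝ) ![v, Complex.I • v] := by
  have h1 := TwoForm.pullback_apply (Y := E) Q η z v (Complex.I • v)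
  have h2 : mfderiv 𝓘(ℂ, E) 𝓘(ℂ, E) Q z (Complex.I • v) =
      (Complex.I • mfderiv 𝓘(ℂ, E) 𝓘(ℂ, E) Q z v : TangentSpace 𝓘(ℂ, E) (Q z)) :=
    ContinuousLinearMap.map_smul (mfderiv 𝓘(ℂ, E) 𝓘(ℂ, E) Q z) Complex.I v
  rw [h2] at h1
  exact h1.symm ▸ hη.positive (Q z) _ fun h => hv (hinj (h.trans (map_zero _).symm))

end Pullback

section PullbackKahler

variable {E : Type*} [NormedAddCommGroup E] [NormedSpace ℂ E]
  {Y : Type*} [TopologicalSpace Y] [ChartedSpace E Y] [IsManifold 𝓘(ℂ, E) ω Y]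
  {η : TwoForm E Y} {Q : E → Y}

/-- Local expression of the pull-back of a 2-form to the model space. -/
theorem TwoForm.pullback_eventuallyEq_inChart {z : E}
    (hQ : ContMDiffAt 𝓘(ℂ, E) 𝓘(ℂ, E) ω Q z) :
    ContDiffAt ℂ ω (chartAt E (Q z) ∘ Q) z ∧
    TwoForm.pullback (Y := E) Q η =ᶠ[𝓝 z] fun x =>
      (η.inChart (chartAt E (Q z)) (chartAt E (Q z) (Q x))).compContinuousLinearMap
        (fderiv ℝ (chartAt E (Q z) ∘ Q) x) := by
  set c := chartAt E (Q z)
  have hman : ∀ n : WithTop ℕ∞, IsManifold 𝓘(ℂ, E) n Y := fun n => IsManifold.of_le (n := ω) (by simp)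
  have hQev : ∀ᶠ x in 𝓝 z, ContMDiffAt 𝓘(ℂ, E) 𝓘(ℂ, E) 1 Q x := by
    have := hman 1
    exact (contMDiffAt_iff_contMDiffAt_nhds (by simp)).1 (hQ.of_le (by simp))
  have hsrc : ∀ᶠ x in 𝓝 z, Q x ∈ c.source :=
    hQ.continuousAt.preimage_mem_nhds (c.open_source.mem_nhds (mem_chart_source E (Q z)))
  have hcQ : ∀ n : WithTop ℕ∞, ∀ x, ContMDiffAt 𝓘(ℂ, E) 𝓘(ℂ, E) n Q x → Q x ∈ c.source →
      ContDiffAt ℂ n (c ∘ Q) x := fun n x hx hs => by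
    have := hman n
    exact ((contMDiffAt_of_mem_maximalAtlas (IsManifold.chart_mem_maximalAtlas (Q z)) hs).comp x
      hx).contDiffAt
  refine ⟨hcQ ω z hQ hsrc.self_of_nhds, ?_⟩
  filter_upwards [hQev, hsrc, hsrc.eventually_nhds] with x hx hxs hxs'
  have h1 : Q =ᶠ[𝓝 x] c.symm ∘ (c ∘ Q) := hxs'.mono fun x' hx' => (c.left_inv hx').symm
  have h2 : DifferentiableAt ℂ (c ∘ Q) x := (hcQ 1 x hx hxs).differentiableAt one_ne_zero
  have h3 : MDifferentiableAt 𝓘(ℂ, E) 𝓘(ℂ, E) c.symm ((c ∘ Q) x) :=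
    (contMDiffAt_symm_of_mem_maximalAtlas (n := ω) (IsManifold.chart_mem_maximalAtlas (Q z))
      (c.map_source hxs)).mdifferentiableAt (by simp)
  rw [TwoForm.pullback_congr η h1, TwoForm.pullback_comp η h3 h2.mdifferentiableAt]
  exact TwoForm.pullback_model _ h2

theorem TwoForm.IsKahler.differentiableAt_pullback (hη : η.IsKahler) {z : E}
    (hQ : ContMDiffAt 𝓘(ℂ, E) 𝓘(ℂ, E) ω Q z) :
    DifferentiableAt ℝ (E := E) (F := E [⋀^Fin 2]→L[ℝ] ℝ) (TwoForm.pullback (Y := E) Q η) z := by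
  obtain ⟨hk, hev⟩ := TwoForm.pullback_eventuallyEq_inChart (η := η) hQ
  -- Order 2, since the pull-back contains the first derivative of the map.
  have hk' : ContDiffAt ℝ 2 (chartAt E (Q z) ∘ Q) z := (hk.restrict_scalars ℝ).of_le (by simp)
  refine DifferentiableAt.congr_of_eventuallyEq ?_ hev
  have h1 : DifferentiableAt ℝ (fderiv ℝ (chartAt E (Q z) ∘ Q)) z :=
    (hk'.fderiv_right (m := 1) (by norm_num)).differentiableAt one_ne_zero
  have h2 : DifferentiableAt ℝ (fun x => η.inChart (chartAt E (Q z)) (chartAt E (Q z) (Q x))) z :=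
    ((hη.contDiffAt_inChart (Q z)).differentiableAt (by simp)).comp z
      (hk'.differentiableAt (by simp))
  exact (h2.hasFDerivAt.continuousAlternatingMapCompContinuousLinearMap
    h1.hasFDerivAt).differentiableAt

theorem TwoForm.IsKahler.contDiffAt_pullback_apply (hη : η.IsKahler) {z : E}
    (hQ : ContMDiffAt 𝓘(ℂ, E) 𝓘(ℂ, E) ω Q z) (v : Fin 2 → E) :
    ContDiffAt ℝ 1 (fun x : E => (TwoForm.pullback (Y := E) Q η x : E [⋀^Fin 2]→L[ℝ] ℝ) v) z := by
  obtain ⟨hk, hev⟩ := TwoForm.pullback_eventuallyEq_inChart (η := η) hQ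
  have hk' : ContDiffAt ℝ 2 (chartAt E (Q z) ∘ Q) z := (hk.restrict_scalars ℝ).of_le (by simp)
  refine ContDiffAt.congr_of_eventuallyEq ?_
    (hev.mono fun x hx => congrArg (fun θ : E [⋀^Fin 2]→L[ℝ] ℝ => θ v) hx)
  have h1 : ContDiffAt ℝ 1 (fderiv ℝ (chartAt E (Q z) ∘ Q)) z :=
    hk'.fderiv_right (by norm_num)
  have h2 : ContDiffAt ℝ 1 (fun x => ContinuousAlternatingMap.toContinuousMultilinearMapCLM ℝ
      (η.inChart (chartAt E (Q z)) (chartAt E (Q z) (Q x)))) z :=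
    (ContinuousLinearMap.contDiff _).contDiffAt.comp z
      (((hη.contDiffAt_inChart (Q z)).of_le (by norm_cast)).comp z (hk'.of_le (by norm_num)))
  have h3 : ContDiffAt ℝ 1 (fun x =>
      ContinuousMultilinearMap.compContinuousLinearMapContinuousMultilinear ℝ
        (fun _ : Fin 2 => E) (fun _ => E) ℝ (fun _ => fderiv ℝ (chartAt E (Q z) ∘ Q) x)) z :=
    (ContinuousMultilinearMap.contDiff _).contDiffAt.comp z (contDiffAt_pi.2 fun _ => h1)
  exact (ContinuousMultilinearMap.apply ℝ (fun _ : Fin 2 => E) ℝ v).contDiff.contDiffAt.comp z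
    (h3.clm_apply h2)

/-- Exterior differentiation commutes with pull-back, and near z the form is pulled back from a
closed form in a chart. -/
theorem TwoForm.IsKahler.extDeriv_pullback (hη : η.IsKahler) {z : E}
    (hQ : ContMDiffAt 𝓘(ℂ, E) 𝓘(ℂ, E) ω Q z) :
    extDeriv (E := E) (F := ℝ) (TwoForm.pullback (Y := E) Q η) z = 0 := by
  obtain ⟨hk, hev⟩ := TwoForm.pullback_eventuallyEq_inChart (η := η) hQ
  have hk' : ContDiffAt ℝ 2 (chartAt E (Q z) ∘ Q) z := (hk.restrict_scalars ℝ).of_le (by simp)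
  refine (Filter.EventuallyEq.extDeriv_eq hev).trans ?_
  refine (_root_.extDeriv_pullback (f := chartAt E (Q z) ∘ Q)
    ((hη.contDiffAt_inChart (Q z)).differentiableAt (by simp)) hk' (by simp)).trans ?_
  rw [Function.comp_apply, hη.closed _ (chart_mem_atlas E _) _ (mem_chart_target E _)]
  ext v
  rfl

end PullbackKahler

/-! ### Lifting the quotient map to a normal covering -/

namespace OTData

variable {K : Type*} [Field K] [NumberField K] {s t : ℕ} (D : OTData K s t)

theorem contractibleSpace_domain (s t : ℕ) : ContractibleSpace (OTDomain s t) :=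
  (convex_domain s t).contractibleSpace 
    ((domain_nonempty (s := s) (t := t)).elim fun z => ⟨z.1, z.2⟩)

/-- A retraction of `ℂ^s × ℂ^t` to its open subset `ℍ^s × ℂ^t` (with junk values outside). -/
noncomputable def toDomain (z : OTModel s t) : OTDomain s t :=
  ((OTDomain s t).openPartialHomeomorphSubtypeCoe domain_nonempty).symm z

theorem toDomain_coe (z : OTDomain s t) : toDomain (z : OTModel s t) = z :=
  ((OTDomain s t).openPartialHomeomorphSubtypeCoe domain_nonempty).left_inv (x := z)
    (Set.mem_univ _)

theorem continuousAt_toDomain {z : OTModel s t} (hz : z ∈ OTDomain s t) :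
    ContinuousAt (toDomain (s := s) (t := t)) z :=
  ((OTDomain s t).openPartialHomeomorphSubtypeCoe domain_nonempty).continuousAt_symm
    (by simpa using hz)

theorem exists_chart_symm_eq {z : OTModel s t} (hz : z ∈ OTDomain s t) :
    ∃ c ∈ atlas (OTModel s t) D.X, z ∈ c.target ∧ ⇑c.symm = D.proj ∘ toDomain := by
  obtain ⟨e, hze, he⟩ := D.isQuotientCoveringMap_proj.isCoveringMap.isLocalHomeomorph ⟨z, hz⟩
  refine ⟨D.chart e, ⟨e, he.symm, rfl⟩, ?_, ?_⟩
  · have h1 : toDomain z = ⟨z, hz⟩ := toDomain_coe ⟨z, hz⟩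
    refine ⟨by simpa using hz, ?_⟩
    change toDomain z ∈ e.source
    rwa [h1]
  · rw [he]
    rfl

/-- Any lift of the quotient map to a normal covering intertwines the action with the deck
transformations. -/
theorem exists_deck {Y : Type} [TopologicalSpace Y] {p : Y → D.X} {q : OTDomain s t → Y}
    (hcov : IsCoveringMap p) (hq : Continuous q) (hpq : p ∘ q = D.proj)
    (hgal : ∀ y y' : Y, p y = p y' → ∃ γ : Y ≃ₜ Y, IsDeckTransformation p γ ∧ γ y = y')
    (g : D.Γ) : ∃ γ : Y ≃ₜ Y, IsDeckTransformation p γ ∧ ∀ z, γ (q z) = q (g • z) := by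
  have hproj : ∀ z, p (q z) = D.proj z := congrFun hpq
  have hsmul : ∀ z, D.proj (g • z) = D.proj z := fun _ => D.isQuotientCoveringMap_proj.map_smul g
  obtain ⟨z₀⟩ := domain_nonempty (s := s) (t := t)
  -- Normality gives agreement at one point; two lifts of the same map on a connected space then
  -- agree everywhere.
  obtain ⟨γ, hγ, hγ₀⟩ := hgal (q z₀) (q (g • z₀)) (by rw [hproj, hproj, hsmul])
  have := contractibleSpace_domain s t
  refine ⟨γ, hγ, congrFun (hcov.eq_of_comp_eq (γ.continuous.comp hq)
    (hq.comp (continuous_const_smul g)) ?_ z₀ hγ₀)⟩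
  funext z
  simp only [Function.comp_apply, hγ _, hproj, hsmul]

variable {Y : Type} [TopologicalSpace Y] [ChartedSpace (OTModel s t) Y]
  {p : Y → D.X} {q : OTDomain s t → Y}

/-- The projection is locally the inverse of a chart, hence holomorphic, and a continuous lift
through a local biholomorphism inherits this. -/
theorem contMDiffAt_lift (hp : IsLocalDiffeomorph 𝓘(ℂ, OTModel s t) 𝓘(ℂ, OTModel s t) ω p)
    (hq : Continuous q) (hpq : p ∘ q = D.proj) {z : OTModel s t} (hz : z ∈ OTDomain s t) :
    ContMDiffAt 𝓘(ℂ, OTModel s t) 𝓘(ℂ, OTModel s t) ω (q ∘ toDomain) z := by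
  obtain ⟨c, hc, hzc, hcs⟩ := D.exists_chart_symm_eq hz
  refine ContMDiffAt.of_comp_isLocalDiffeomorph (f := D.proj ∘ toDomain) hp
    (hq.continuousAt.comp (continuousAt_toDomain hz)) ?_ ?_
  · rw [← hcs]
    exact contMDiffAt_symm_of_mem_maximalAtlas (IsManifold.subset_maximalAtlas hc) hzc
  · rw [← Function.comp_assoc, hpq]

/-- A chart of X(K,U) composed with p is a local left inverse of the lift. Injectivity is what keeps
the pulled-back form positive. -/
theorem mfderiv_lift_injective
    (hp : IsLocalDiffeomorph 𝓘(ℂ, OTModel s t) 𝓘(ℂ, OTModel s t) ω p)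
    (hq : Continuous q) (hpq : p ∘ q = D.proj) {z : OTModel s t} (hz : z ∈ OTDomain s t) :
    Function.Injective
      (mfderiv 𝓘(ℂ, OTModel s t) 𝓘(ℂ, OTModel s t) (q ∘ toDomain (s := s) (t := t)) z) := by
  obtain ⟨c, hc, hzc, hcs⟩ := D.exists_chart_symm_eq hz
  have hQ := (D.contMDiffAt_lift hp hq hpq hz).mdifferentiableAt (by simp)
  have h1 : p ((q ∘ toDomain) z) = c.symm z := by
    rw [hcs, ← hpq]; rfl
  have hcp : MDifferentiableAt 𝓘(ℂ, OTModel s t) 𝓘(ℂ, OTModel s t) (c ∘ p)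
      ((q ∘ toDomain) z) := by
    refine MDifferentiableAt.comp _ ?_ ((hp _).mdifferentiableAt (by simp))
    rw [h1]
    exact (contMDiffAt_of_mem_maximalAtlas (n := ω) (IsManifold.subset_maximalAtlas hc)
      (c.map_target hzc)).mdifferentiableAt (by simp)
  have h2 : (c ∘ p) ∘ (q ∘ toDomain) =ᶠ[𝓝 z] id := by
    filter_upwards [c.open_target.mem_nhds hzc] with x hx
    have h3 : p ((q ∘ toDomain) x) = c.symm x := by
      rw [hcs, ← hpq]; rfl
    rw [Function.comp_apply, Function.comp_apply, h3, c.right_inv hx, id]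
  have h3 := mfderiv_comp z hcp hQ
  rw [h2.mfderiv_eq, mfderiv_id] at h3
  intro v w hvw
  have h4 := fun v => congrArg (fun A : OTModel s t →L[ℂ] OTModel s t => A v) h3
  exact (h4 v).trans ((congrArg (mfderiv 𝓘(ℂ, OTModel s t) 𝓘(ℂ, OTModel s t) (c ∘ p)
    ((q ∘ toDomain) z)) hvw).trans (h4 w).symm)

theorem fderiv_affine (g : D.Γ) (z v : OTModel s t) : fderiv ℂ (D.affine g) z v =
    D.linearPart g v := by
  have h : HasFDerivAt (D.affine g) (ContinuousLinearMap.pi fun i =>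
      D.σ i (((g.right : (𝓞 K)ˣ) : 𝓞 K) : K) • ContinuousLinearMap.proj (R := ℂ)
        (φ := fun _ : Fin s ⊕ Fin t => ℂ) i) z := by
    refine hasFDerivAt_pi.2 fun i => ?_
    exact ((hasFDerivAt_apply i z).const_mul _).add_const _
  rw [h.fderiv]
  rfl

/-- Differentiates the identity (lift ∘ g) = (γ ∘ lift): pulling η back along the two sides gives
the two sides of the equation. -/
theorem pullback_lift_homothetic
    (hp : IsLocalDiffeomorph 𝓘(ℂ, OTModel s t) 𝓘(ℂ, OTModel s t) ω p)
    (hq : Continuous q) (hpq : p ∘ q = D.proj) {η : TwoForm (OTModel s t) Y} {g : D.Γ}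
    {γ : Y ≃ₜ Y} (hγ : IsDeckTransformation p γ) (hγq : ∀ z, γ (q z) = q (g • z)) {χ : ℝ}
    (hχ : ∀ y, TwoForm.pullback γ η y = χ • η y) {z : OTModel s t} (hz : z ∈ OTDomain s t)
    (v w : OTModel s t) :
    (TwoForm.pullback (Y := OTModel s t) (q ∘ toDomain) η (D.affine g z) :
      OTModel s t [⋀^Fin 2]→L[ℝ] ℝ) ![D.linearPart g v, D.linearPart g w] =
    χ * (TwoForm.pullback (Y := OTModel s t) (q ∘ toDomain) η z :
      OTModel s t [⋀^Fin 2]→L[ℝ] ℝ) ![v, w] := by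
  have hQ := fun {z : OTModel s t} (hz : z ∈ OTDomain s t) =>
    (D.contMDiffAt_lift hp hq hpq hz).mdifferentiableAt (by simp)
  have haff : DifferentiableAt ℂ (D.affine g) z :=
    (D.contDiff_affine g).contDiffAt.differentiableAt (by simp)
  have hγd : MDifferentiableAt 𝓘(ℂ, OTModel s t) 𝓘(ℂ, OTModel s t) γ ((q ∘ toDomain) z) :=
    (ContMDiffAt.of_comp_isLocalDiffeomorph hp γ.continuous.continuousAt (hp _).contMDiffAt
      (Filter.Eventually.of_forall hγ)).mdifferentiableAt (by simp)
  have h1 : (q ∘ toDomain) ∘ D.affine g =ᶠ[𝓝 z] γ ∘ (q ∘ toDomain) := by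
    filter_upwards [(OTDomain s t).isOpen.mem_nhds hz] with x hx
    have h2 := toDomain_coe (⟨x, hx⟩ : OTDomain s t)
    have h3 := toDomain_coe (g • ⟨x, hx⟩ : OTDomain s t)
    rw [coe_smul] at h3
    simp only [Function.comp_apply]
    rw [h2, h3, hγq]
  have h2 := TwoForm.pullback_congr η h1
  rw [TwoForm.pullback_comp η (hQ (D.affine_mem g hz)) haff.mdifferentiableAt,
    TwoForm.pullback_comp η hγd (hQ hz)] at h2
  have h3 := congrArg (fun θ : OTModel s t [⋀^Fin 2]→L[ℝ] ℝ => θ ![v, w]) h2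
  have h5 : ∀ v, mfderiv 𝓘(ℂ, OTModel s t) 𝓘(ℂ, OTModel s t) (D.affine g) z v =
      D.linearPart g v := fun v => by
    rw [mfderiv_eq_fderiv]
    exact D.fderiv_affine g z v
  have h4 := (TwoForm.pullback_apply (D.affine g)
    (TwoForm.pullback (Y := OTModel s t) (q ∘ toDomain) η) z v w).trans
    (congrArg₂ (fun a b : OTModel s t =>
      (TwoForm.pullback (Y := OTModel s t) (q ∘ toDomain) η (D.affine g z) :
        OTModel s t [⋀^Fin 2]→L[ℝ] ℝ) ![a, b]) (h5 v) (h5 w))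
  refine h4.symm.trans (h3.trans ?_)
  unfold TwoForm.pullback
  have h6 := hχ ((q ∘ toDomain) z)
  unfold TwoForm.pullback at h6
  rw [h6]
  rfl

end OTData

/-! ### Conclusion -/

theorem mainTheorem1 {K : Type*} [Field K] [NumberField K] {s t : ℕ} (D : OTData K s t)
    (hs : 1 < s) (hst : s < t) : ¬ IsLCK (OTModel s t) D.X := by
  rintro ⟨-, Y, _, _, _, p, η, -, hcov, hsurj, hp, hgal, hη, hdeck⟩
  have := OTData.contractibleSpace_domain s t
  have := (OTDomain s t).isOpen.locallyPathConnectedSpace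
  obtain ⟨z₀⟩ := OTData.domain_nonempty (s := s) (t := t)
  obtain ⟨y₀, hy₀⟩ := hsurj (D.proj z₀)
  obtain ⟨q, ⟨-, hpq⟩, -⟩ := hcov.existsUnique_continuousMap_lifts
    ⟨D.proj, D.isQuotientCoveringMap_proj.isCoveringMap.continuous⟩ z₀ y₀ hy₀
  have hpq' : p ∘ q = D.proj := hpq
  have hQ := fun {z : OTModel s t} (hz : z ∈ OTDomain s t) =>
    D.contMDiffAt_lift hp q.continuous hpq' hz
  let θ : OTModel s t → OTModel s t [⋀^Fin 2]→L[ℝ] ℝ :=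
    TwoForm.pullback (Y := OTModel s t) (q ∘ OTData.toDomain) η
  have hpos : ∀ z ∈ OTDomain s t, ∀ v, v ≠ 0 → 0 < θ z ![v, Complex.I • v] := fun z hz v hv =>
    hη.pullback_pos (D.mfderiv_lift_injective hp q.continuous hpq' hz) hv
  obtain ⟨χ, hχpos, hχ⟩ := D.exists_character hpos fun g => by
    obtain ⟨γ, hγ, hγq⟩ := D.exists_deck hcov q.continuous hpq' hgal g
    obtain ⟨c, -, hc⟩ := hdeck γ hγ
    exact ⟨c, fun z hz v w =>
      D.pullback_lift_homothetic hp q.continuous hpq' hγ hγq hc hz v w⟩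
  have hnorm := D.norm_sq_eq_character (η := θ)
    (fun z hz => hη.differentiableAt_pullback (hQ hz))
    (fun v z hz => (hη.contDiffAt_pullback_apply (hQ hz) v).contDiffWithinAt)
    (fun z hz => hη.extDeriv_pullback (hQ hz)) hpos hχpos hχ
  refine D.not_forall_norm_eq hst fun u hu j k => ?_
  exact (sq_eq_sq₀ (norm_nonneg _) (norm_nonneg _)).1
    ((hnorm ⟨u, hu⟩ j).trans (hnorm ⟨u, hu⟩ k).symm)
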